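/- Let $X,Y,Z$ be the Pauli matrices, $H=\frac1{\sqrt2}\begin{pmatrix}1&1\\1&-1\end{pmatrix}$, $T=\mathrm{diag}(1,e^{i\pi/4})$, and let $CNot\,|x,y\rangle=|x,x\oplus y\rangle$. Measuring an observable $O$ with $O^2=1$ means applying one of the projectors $\frac{1\pm O}{2}$ (outcome $\pm1$) with the usual probabilities; $A^{(a)}$ is $A$ acting on qubit $a$. A computation on $n$ logical qubits uses a register of $n+1$ qubits: at each time $n$ of them hold the data and the remaining one is the auxiliary qubit. It uses two kinds of steps, which consist of measurements only. (i) The generalized state transfer of a data qubit $a$, with one-qubit unitaries $U,V$: if $b$ is the auxiliary qubit, measure successively $(VXV^\dagger)^{(b)}$, $(U^\dagger ZU)^{(a)}\otimes(VZV^\dagger)^{(b)}$, $(U^\dagger XU)^{(a)}$; then $b$ holds the data of $a$, and $a$ becomes the auxiliary qubit. (ii) The $CNot$ step on distinct data qubits $a,b$ with auxiliary qubit $c$: measure successively $Z^{(c)}$, $Z^{(a)}\otimes X^{(c)}$, $Z^{(c)}\otimes X^{(b)}$, $X^{(c)}$. An automaton is a finite set of states with a start state, each state being either halting or labelled by one step,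 with a next state for every tuple of outcomes of that step. It simulates an operator $W$ on $n$ qubits if, for every data state $|\varphi\rangle$ and every initial state of the auxiliary qubit, it halts with probability one, and whenever it halts the register is in a product state of the data qubits and the auxiliary qubit, with the data in the state $W|\varphi\rangle$, up to a scalar factor that depends on the outcomes and the initial auxiliary state but not on $|\varphi\rangle$. A set $\mathcal O$ of one- and two-qubit observables suffices to simulate $W$ if some automaton all of whose measurements are of observables in $\mathcal O$ (placed on arbitrary qubits, a two-qubit observable on a pair of qubits in either order) simulates $W$. Then this model is quantum universal: 1. For every $n$, every unitary transformation of $n$ qubits is simulated by some automaton. 2. Each of the two families $\mathcal O_1=\{Z,\,X,\,\frac{1}{\sqrt2}(X+Y),\,Z\otimes Z,\,Z\otimes X\}$ and $\mathcal O_2=\{Z,\,X,\,\frac{1}{\sqrt2}(X+Y),\,Z\otimes X\}$, the second of which has a single two-qubit observable, suffices to simulate every quantum circuit, on any number of qubits, over the gate set $\{H,T,CNot\}$, and every quantum circuit over the gate set $\{H,HT,CNot\}$. 3. Consequently each of $\mathcal O_1,\mathcal O_2$ is universal: for every $n$, every unitary $U$ on $n$ qubits and every $\varepsilon>0$ there is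 a unitary $V$ with $\|V-U\|<\varepsilon$ (operator norm) which the family suffices to simulate. -/

import Mathlib

open scoped Matrix Kronecker Topology

namespace StateTransfer

noncomputable section

/-! ### One- and two-qubit matrices -/

/-- Matrices on one qubit, in the computational basis `|0⟩, |1⟩`. -/
abbrev Mat1 := Matrix (Fin 2) (Fin 2) ℂ

/-- Matrices on two qubits, in the computational basis `|x⟩ ⊗ |y⟩ = |(x, y)⟩`. -/
abbrev Mat2 := Matrix (Fin 2 × Fin 2) (Fin 2 × Fin 2) ℂ

def pauliX : Mat1 := !![0, 1; 1, 0]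

def pauliY : Mat1 := !![0, -Complex.I; Complex.I, 0]

def pauliZ : Mat1 := !![1, 0; 0, -1]

/-- The observable `(X + Y) / √2`. -/
def diagXY : Mat1 := ((Real.sqrt 2 : ℝ) : ℂ)⁻¹ • (pauliX + pauliY)

def gateH : Mat1 := ((Real.sqrt 2 : ℝ) : ℂ)⁻¹ • !![1, 1; 1, -1]

def gateT : Mat1 := !![1, 0; 0, Complex.exp (Complex.I * Real.pi / 4)]

/-- Controlled-not, the first qubit being the control: `|x, y⟩ ↦ |x, x + y⟩`
(addition in `Fin 2` is modulo 2). -/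
def gateCNot : Mat2 :=
  Matrix.of fun p q => if p = (q.1, q.1 + q.2) then 1 else 0

/-- A family of one-qubit matrices and two-qubit matrices: a family of observables, or a set of
gates. -/
structure Family where
  one : Set Mat1
  two : Set Mat2

/-- The observables `Z, X, (X+Y)/√2, Z ⊗ Z, Z ⊗ X`. -/
def obsFamily₁ : Family where
  one := {pauliZ, pauliX, diagXY}
  two := {pauliZ ⊗ₖ pauliZ, pauliZ ⊗ₖ pauliX}

/-- The observables `Z, X, (X+Y)/√2, Z ⊗ X`. -/
def obsFamily₂ : Family where
  one := {pauliZ, pauliX, diagXY}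
  two := {pauliZ ⊗ₖ pauliX}

/-- No restriction on the observables. -/
def allObs : Family where
  one := Set.univ
  two := Set.univ

/-- The gate set `H, T, CNot`. -/
def gatesHT : Family where
  one := {gateH, gateT}
  two := {gateCNot}

/-- The gate set `H, HT, CNot`. -/
def gatesHHT : Family where
  one := {gateH, gateH * gateT}
  two := {gateCNot}

/-! ### Registers -/

/-- (Unnormalised) pure states of a register whose qubits are labelled by `W`. -/
abbrev Ket (W : Type) := (W → Fin 2) → ℂ

/-- Operators on a register whose qubits are labelled by `W`. -/
abbrev Op (W : Type) := Matrix (W → Fin 2) (W → Fin 2) ℂ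

/-- The squared norm of a state. For the unnormalised state left by a sequence of measurement
outcomes on a unit vector, it is the probability of these outcomes. -/
def weight {W : Type} [Fintype W] [DecidableEq W] (ψ : Ket W) : ℝ := ∑ x, Complex.normSq (ψ x)

/-- A one-qubit matrix at a qubit, or a two-qubit matrix at an ordered pair of distinct qubits. -/
inductive LocalOp (W : Type) where
  | one (a : W) (M : Mat1)
  | two (a b : W) (hab : a ≠ b) (M : Mat2)

/-- The operator on the whole register: the given matrix on the named qubits, tensored with the
identity on all the others. -/
def LocalOp.toOp {W : Type} [Fintype W] [DecidableEq W] : LocalOp W → Op W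
  | .one a M => Matrix.of fun x y =>
      if ∀ w, w ≠ a → x w = y w then M (x a) (y a) else 0
  | .two a b _ M => Matrix.of fun x y =>
      if ∀ w, w ≠ a → w ≠ b → x w = y w then M (x a, x b) (y a, y b) else 0

/-- The local matrix belongs to the family. A two-qubit element `M` may be used on the pair of
qubits in either order, so that `X^(a) ⊗ Z^(b)` is an instance of `Z ⊗ X`. -/
def LocalOp.MemFamily {W : Type} (F : Family) : LocalOp W → Prop
  | .one _ M => M ∈ F.one
  | .two _ _ _ M => M ∈ F.two ∨ M.submatrix Prod.swap Prod.swap ∈ F.two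

/-- The projector for outcome `1` (`s = true`) or `-1` (`s = false`) of the measurement of an
observable `M` with `M² = 1`. -/
def proj {W : Type} [Fintype W] [DecidableEq W] (M : Op W) (s : Bool) : Op W :=
  (2 : ℂ)⁻¹ • (1 + (if s then (1 : ℂ) else -1) • M)

/-! ### Quantum circuits -/

/-- Circuits on `n` qubits: sequences of gates, the head of the list being applied first. -/
abbrev Circuit (n : ℕ) := List (LocalOp (Fin n))

/-- All gates of the circuit belong to the gate set `G`. -/
def Circuit.Over {n : ℕ} (c : Circuit n) (G : Family) : Prop := ∀ g ∈ c, g.MemFamily G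

/-- The operator computed by a circuit. -/
def Circuit.toOp {n : ℕ} (c : Circuit n) : Op (Fin n) :=
  (c.map LocalOp.toOp).reverse.prod

/-! ### Steps of simulation with one auxiliary qubit

The physical register of a computation on `n` qubits has `n + 1` qubits, labelled by
`Option (Fin n)`. As a state transfer moves the state of a qubit to another qubit, the place of the
data in the register changes during the computation. -/

/-- Where the data are: `e (some i)` is the physical qubit that holds the `i`-th logical qubit, and
`e none` is the physical qubit that is currently the auxiliary one. -/
abbrev Placement (n : ℕ) := Equiv.Perm (Option (Fin n))

/-- The physical state in which the logical qubits, placed according to `e`, are in the state `φ`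
and the auxiliary qubit is in the state `χ`: the product state `φ ⊗ χ`. -/
def join {n : ℕ} (e : Placement n) (φ : Ket (Fin n)) (χ : Fin 2 → ℂ) : Ket (Option (Fin n)) :=
  fun x => φ (fun i => x (e (some i))) * χ (x (e none))

/-- Steps of simulation: the generalised state transfer of the `i`-th logical qubit, with unitary
matrices `U` (before the transfer) and `V` (after it), and the step for `CNot` with control `i`
and target `j`. -/
inductive Step (n : ℕ) where
  | transfer (i : Fin n) (U V : Matrix.unitaryGroup (Fin 2) ℂ)
  | cnot (i j : Fin n) (hij : i ≠ j)

/-- The number of measurements of a step. -/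
def Step.arity {n : ℕ} : Step n → ℕ
  | .transfer _ _ _ => 3
  | .cnot _ _ _ => 4

/-- The observables measured during a step, in this order.

For a generalised state transfer from the data qubit `a` to the auxiliary qubit `b`:
`(V X V†)^(b)`, `(U† Z U)^(a) ⊗ (V Z V†)^(b)`, `(U† X U)^(a)`; the case `U = V = 1` is the plain
state transfer `X^(b)`, `Z^(a) ⊗ Z^(b)`, `X^(a)`.

For `CNot` with control `a`, target `b` and auxiliary qubit `c`:
`Z^(c)`, `Z^(a) ⊗ X^(c)`, `Z^(c) ⊗ X^(b)`, `X^(c)`. -/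
def Step.obs {n : ℕ} (e : Placement n) : (s : Step n) → Fin s.arity → LocalOp (Option (Fin n))
  | .transfer i U V =>
      ![.one (e none) (V.1 * pauliX * V.1ᴴ),
        .two (e (some i)) (e none) (fun h => Option.some_ne_none i (e.injective h))
          ((U.1ᴴ * pauliZ * U.1) ⊗ₖ (V.1 * pauliZ * V.1ᴴ)),
        .one (e (some i)) (U.1ᴴ * pauliX * U.1)]
  | .cnot i j _ =>
      ![.one (e none) pauliZ,
        .two (e (some i)) (e none) (fun h => Option.some_ne_none i (e.injective h))
          (pauliZ ⊗ₖ pauliX),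
        .two (e none) (e (some j)) (fun h => Option.some_ne_none j (e.injective h).symm)
          (pauliZ ⊗ₖ pauliX),
        .one (e none) pauliX]

/-- The placement of the data after a step: a state transfer exchanges the roles of the data qubit
and of the auxiliary qubit. -/
def Step.move {n : ℕ} (e : Placement n) : Step n → Placement n
  | .transfer i _ _ => (Equiv.swap (some i) none).trans e
  | .cnot _ _ _ => e

/-- The operator by which a step acts on the physical register when the outcomes of its
measurements are `o`: the product of the corresponding projectors, the first measurement being the
rightmost factor. -/
def Step.kraus {n : ℕ} (e : Placement n) (s : Step n) (o : Fin s.arity → Bool) :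
    Op (Option (Fin n)) :=
  (List.ofFn fun k => proj (s.obs e k).toOp (o k)).reverse.prod

/-! ### Automata -/

/-- A finite automaton each of whose states encapsulates a step of simulation, with a transition
for each tuple of classical outcomes, or is a halting state (`action q = none`). -/
structure Automaton (n : ℕ) where
  State : Type
  finite : Finite State
  start : State
  action : State → Option (Σ s : Step n, (Fin s.arity → Bool) → State)

namespace Automaton

variable {n : ℕ}

/-- All measurements performed by the automaton are of observables of the family `O`. -/
def UsesOnly (A : Automaton n) (O : Family) : Prop :=
  ∀ (q : A.State) (s : Step n) (next : (Fin s.arity → Bool) → A.State),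
    A.action q = some ⟨s, next⟩ → ∀ (e : Placement n) (k : Fin s.arity), (s.obs e k).MemFamily O

/-- `A.Branch q e K`: for some sequence of outcomes, the automaton goes from its start state, with
the `i`-th logical qubit in the `i`-th physical qubit, to the state `q` with placement `e` of the
data, and acts by the operator `K` on the physical register. -/
inductive Branch (A : Automaton n) : A.State → Placement n → Op (Option (Fin n)) → Prop
  | init : Branch A A.start (Equiv.refl _) 1
  | step {q : A.State} {e : Placement n} {K : Op (Option (Fin n))} {s : Step n}
      {next : (Fin s.arity → Bool) → A.State} (o : Fin s.arity → Bool) :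
      Branch A q e K → A.action q = some ⟨s, next⟩ →
      Branch A (next o) (s.move e) (s.kraus e o * K)

/-- The probability, multiplied by `weight ψ`, that the automaton started in the state `q` with
placement `e` and physical state `ψ` halts after at most `N` steps. -/
def haltWeight (A : Automaton n) :
    ℕ → A.State → Placement n → Ket (Option (Fin n)) → ℝ
  | 0, q, _, ψ =>
      match A.action q with
      | none => weight ψ
      | some _ => 0
  | N + 1, q, e, ψ =>
      match A.action q with
      | none => weight ψ
      | some ⟨s, next⟩ => ∑ o, haltWeight A N (next o) (s.move e) (s.kraus e o *ᵥ ψ)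

/-- The automaton simulates `U`, on every state `φ` of the data and every initial state `χ` of the
auxiliary qubit: it halts with probability one, and whenever it halts, the data are in the state
`U φ`. (The scalar by which a sequence of outcomes multiplies the data, made of a global phase and
of the square root of a probability, is part of `χ'`; it does not depend on `φ`.) -/
def Simulates (A : Automaton n) (U : Op (Fin n)) : Prop :=
  (∀ (φ : Ket (Fin n)) (χ : Fin 2 → ℂ),
    Filter.Tendsto (fun N => A.haltWeight N A.start (Equiv.refl _) (join (Equiv.refl _) φ χ))
      Filter.atTop (𝓝 (weight (join (Equiv.refl _) φ χ)))) ∧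
  ∀ (q : A.State) (e : Placement n) (K : Op (Option (Fin n))),
    A.Branch q e K → A.action q = none →
      ∀ χ : Fin 2 → ℂ, ∃ χ' : Fin 2 → ℂ, ∀ φ : Ket (Fin n),
        K *ᵥ join (Equiv.refl _) φ χ = join e (U *ᵥ φ) χ'

end Automaton

/-- Some automaton made of steps of simulation, with a single auxiliary qubit, and measuring only
observables of the family `O`, simulates `U`. -/
def Simulable (O : Family) {n : ℕ} (U : Op (Fin n)) : Prop :=
  ∃ A : Automaton n, A.UsesOnly O ∧ A.Simulates U

/-- Every circuit over the gate set `G`, on any number of qubits, is simulated with observables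
of `O`. -/
def SimulatesCircuits (O G : Family) : Prop :=
  ∀ (n : ℕ) (c : Circuit n), c.Over G → Simulable O c.toOp

/-- Every unitary transformation, on any number of qubits, is simulated with observables of `O`. -/
def ExactlyUniversal (O : Family) : Prop :=
  ∀ (n : ℕ) (U : Op (Fin n)), U ∈ Matrix.unitaryGroup (Fin n → Fin 2) ℂ → Simulable O U

open scoped Matrix.Norms.L2Operator in
/-- Every unitary transformation, on any number of qubits, is approximated to any precision, in
operator norm, by unitary transformations that are simulated with observables of `O`. -/
def Universal (O : Family) : Prop :=
  ∀ (n : ℕ) (U : Op (Fin n)), U ∈ Matrix.unitaryGroup (Fin n → Fin 2) ℂ →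
    ∀ ε : ℝ, 0 < ε → ∃ V ∈ Matrix.unitaryGroup (Fin n → Fin 2) ℂ, ‖V - U‖ < ε ∧ Simulable O V

end

end StateTransfer

open scoped Matrix Kronecker Topology

namespace StateTransfer

noncomputable section

/-! ### Operators acting on one or two qubits of a register -/

section LocalOperators

variable {W : Type} [Fintype W] [DecidableEq W]

/-! A step never fails; it only adds a known error. A transfer applies `V σ U` to the data, where
`σ` is a Pauli operator read off from the outcomes and is uniformly distributed whatever the state
of the register (`Step.implements_transfer`, `sum_weight_kraus_transfer`). The `CNot` step applies a
controlled-not followed by Pauli operators (`Step.implements_cnot`). So it suffices to be able to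
apply a prescribed Pauli operator and, after a transfer with `V ≠ 1`, the operator `V σ V†`.

Pauli operators come from a random walk (`programmable_pauli`): repeated transfers whose gates
cancel in pairs multiply the data by random Pauli operators, and each round hits the wanted one with
probability 1/4. Plain transfers would need `Z ⊗ Z`; inserting `H` before one transfer and after the
next replaces it by `X ⊗ Z` and `Z ⊗ X`. Hence the second family suffices, and the results for the
first follow by inclusion. `H` is a corrected transfer; `T†` comes from one that applies `H T†`,
whose errors `H σ H` are again Pauli operators up to a scalar; and `T` is a power of `T†`.

For the bookkeeping, `Realizes` attaches to each automaton state the operator applied so far, and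
`HaltsUniformly` gives geometric decay of the weight that has not halted. Both survive running
automata in succession and branching on outcomes, so the `Programmable` operators form a monoid
closed under nonzero scalars.

For universality, a monoid with all one-qubit unitaries, controlled-nots and phases contains every
unitary (`unitary_mem_of_gates`). Controlled-nots turn one-qubit phases into parity phases, which
span all diagonal phases; controlled real rotations then carry any vector to a multiple of a basis
vector; and conjugating diagonal matrices gives the reflections needed to reduce a unitary to the
identity column by column (`unitary_mem_of_transitive`).

Approximate universality applies this to the closure of the programmable unitaries. One-qubit
unitaries lie there by `unitary_mem_of_gateH_gateT`: `T (H T H)` is up to phase a rotation whose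
half-angle has cosine `(2 + √2)/4`, so its powers are dense in the rotations about its axis.
Conjugation by `gateSH * gateT * gateSHᴴ` brings that axis into the xy-plane, and a diagonal matrix
then makes the rotation real. -/

theorem LocalOp.toOp_one_mulVec (a : W) (M : Mat1) (ψ : Ket W) (x : W → Fin 2) :
    ((LocalOp.one a M).toOp *ᵥ ψ) x = ∑ t, M (x a) t * ψ (Function.update x a t) := by
  simp only [LocalOp.toOp, Matrix.mulVec, dotProduct, Matrix.of_apply]
  symm
  refine Finset.sum_of_injOn (fun t => Function.update x a t) ?_ ?_ ?_ ?_
  · intro s _ t _ h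
    simpa using congrFun h a
  · intro t _; simp
  · intro y _ hy
    rw [if_neg, zero_mul]
    intro h
    apply hy
    refine ⟨y a, by simp, ?_⟩
    funext w
    by_cases hw : w = a
    · subst hw; simp
    · simp [hw, h w hw]
  · intro t _
    rw [if_pos]
    · simp
    · intro w hw; simp [hw]

theorem LocalOp.toOp_two_mulVec (a b : W) (hab : a ≠ b) (M : Mat2) (ψ : Ket W) (x : W → Fin 2) :
    ((LocalOp.two a b hab M).toOp *ᵥ ψ) x =
      ∑ p, M (x a, x b) p * ψ (Function.update (Function.update x a p.1) b p.2) := by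
  simp only [LocalOp.toOp, Matrix.mulVec, dotProduct, Matrix.of_apply]
  symm
  refine Finset.sum_of_injOn (fun p => Function.update (Function.update x a p.1) b p.2) ?_ ?_ ?_ ?_
  · intro s _ t _ h
    have h1 := congrFun h a
    have h2 := congrFun h b
    simp [hab] at h1 h2
    exact Prod.ext h1 h2
  · intro t _; simp
  · intro y _ hy
    rw [if_neg, zero_mul]
    intro h
    apply hy
    refine ⟨(y a, y b), by simp, ?_⟩
    funext w
    by_cases hb : w = b
    · subst hb; simp
    by_cases hw : w = a
    · subst hw; simp [hb]
    · simp [hw, hb, h w hw hb]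
  · intro t _
    rw [if_pos]
    · simp [hab]
    · intro w hw hb; simp [hw, hb]

theorem Op.ext_mulVec {M N : Op W} (h : ∀ (ψ : Ket W) (x : W → Fin 2), (M *ᵥ ψ) x = (N *ᵥ ψ) x) :
    M = N := by
  apply Matrix.toLin'.injective
  apply LinearMap.ext
  intro ψ
  funext x
  simpa using h ψ x

/-- A one-qubit matrix placed on the qubit `a`, as an algebra homomorphism. -/
def onQubit (a : W) : Mat1 →ₐ[ℂ] Op W :=
  AlgHom.ofLinearMap
    { toFun := fun M => (LocalOp.one a M).toOp
      map_add' := fun M N => by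
        ext x y
        simp only [LocalOp.toOp, Matrix.of_apply, Matrix.add_apply]
        split_ifs <;> simp
      map_smul' := fun c M => by
        ext x y
        simp only [LocalOp.toOp, Matrix.of_apply, Matrix.smul_apply, RingHom.id_apply]
        split_ifs <;> simp }
    (by
      apply Op.ext_mulVec
      intro ψ x
      change ((LocalOp.one a (1 : Mat1)).toOp *ᵥ ψ) x = _
      rw [LocalOp.toOp_one_mulVec]
      simp [Matrix.one_apply])
    (fun M N => by
      apply Op.ext_mulVec
      intro ψ x
      change ((LocalOp.one a (M * N)).toOp *ᵥ ψ) x =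
        (((LocalOp.one a M).toOp * (LocalOp.one a N).toOp) *ᵥ ψ) x
      rw [← Matrix.mulVec_mulVec]
      simp [LocalOp.toOp_one_mulVec, Matrix.mul_apply]
      ring)

theorem toOp_one (a : W) (M : Mat1) : (LocalOp.one a M).toOp = onQubit a M := rfl

theorem onQubit_mulVec (a : W) (M : Mat1) (ψ : Ket W) (x : W → Fin 2) :
    (onQubit a M *ᵥ ψ) x = ∑ t, M (x a) t * ψ (Function.update x a t) :=
  LocalOp.toOp_one_mulVec a M ψ x

theorem onQubit_commute {a b : W} (hab : a ≠ b) (M N : Mat1) :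
    Commute (onQubit a M) (onQubit b N) := by
  apply Op.ext_mulVec
  intro ψ x
  simp only [← Matrix.mulVec_mulVec, onQubit_mulVec, Fin.sum_univ_two,
    Function.update_of_ne hab, Function.update_of_ne hab.symm]
  simp only [Function.update_comm hab]
  ring

theorem onQubit_conjTranspose (a : W) (M : Mat1) : (onQubit a M)ᴴ = onQubit a Mᴴ := by
  ext x y
  simp only [← toOp_one, LocalOp.toOp, Matrix.conjTranspose_apply, Matrix.of_apply]
  by_cases h : ∀ w, w ≠ a → x w = y w
  · rw [if_pos h, if_pos fun w hw => (h w hw).symm]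
  · rw [if_neg h, if_neg fun h' => h fun w hw => (h' w hw).symm, star_zero]

theorem onQubit_mem_unitary (a : W) {M : Mat1} (hM : M ∈ Matrix.unitaryGroup (Fin 2) ℂ) :
    onQubit a M ∈ Matrix.unitaryGroup (W → Fin 2) ℂ := by
  rw [Matrix.mem_unitaryGroup_iff, Matrix.star_eq_conjTranspose, onQubit_conjTranspose, ← map_mul,
    ← Matrix.star_eq_conjTranspose, Matrix.mem_unitaryGroup_iff.1 hM, map_one]

/-- Every two-qubit observable of a step is a tensor product, so this reduces the algebra of the
steps to products of commuting one-qubit operators. -/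
theorem toOp_two_kronecker {a b : W} (hab : a ≠ b) (M N : Mat1) :
    (LocalOp.two a b hab (M ⊗ₖ N)).toOp = onQubit a M * onQubit b N := by
  apply Op.ext_mulVec
  intro ψ x
  simp only [← Matrix.mulVec_mulVec, onQubit_mulVec, LocalOp.toOp_two_mulVec, Fin.sum_univ_two,
    Fintype.sum_prod_type, Matrix.kroneckerMap_apply, Function.update_of_ne hab.symm]
  ring

theorem toOp_two_swap {a b : W} (hab : a ≠ b) (M : Mat2) :
    (LocalOp.two a b hab M).toOp =
      (LocalOp.two b a hab.symm (M.submatrix Prod.swap Prod.swap)).toOp := by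
  apply Op.ext_mulVec
  intro ψ x
  simp only [LocalOp.toOp_two_mulVec, Fin.sum_univ_two,
    Fintype.sum_prod_type, Matrix.submatrix_apply, Prod.swap_prod_mk]
  simp only [Function.update_comm hab]
  ring

/-- The controlled-not with control `a` and target `b` on a register. -/
def cnotOp {a b : W} (hab : a ≠ b) : Op W := (LocalOp.two a b hab gateCNot).toOp

theorem cnotOp_mulVec {a b : W} (hab : a ≠ b) (ψ : Ket W) (x : W → Fin 2) :
    (cnotOp hab *ᵥ ψ) x = ψ (Function.update x b (x a + x b)) := by
  simp only [cnotOp, LocalOp.toOp_two_mulVec, gateCNot, Matrix.of_apply]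
  -- Addition modulo 2 of the control is an involution, so the only nonzero entry in row `(s, t)` is
  -- in column `(s, s + t)`.
  rw [Finset.sum_eq_single (x a, x a + x b)]
  · rw [if_pos]
    · simp
    · ext
      · rfl
      · have : ∀ s t : Fin 2, t = s + (s + t) := by decide
        simpa using congrArg Fin.val (this (x a) (x b))
  · rintro ⟨s, t⟩ _ hne
    rw [if_neg, zero_mul]
    rintro h
    apply hne
    simp only [Prod.mk.injEq] at h ⊢
    obtain ⟨h1, h2⟩ := h
    refine ⟨h1.symm, ?_⟩
    rw [h2, h1]
    have : ∀ s t : Fin 2, t = s + (s + t) := by decide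
    exact this _ _
  · simp

theorem cnotOp_mul_self {a b : W} (hab : a ≠ b) : cnotOp hab * cnotOp hab = 1 := by
  apply Op.ext_mulVec
  intro ψ x
  rw [← Matrix.mulVec_mulVec, cnotOp_mulVec, cnotOp_mulVec, Matrix.one_mulVec]
  have : ∀ s t : Fin 2, s + (s + t) = t := by decide
  simp [Function.update_of_ne hab, this]

theorem cnotOp_conjTranspose {a b : W} (hab : a ≠ b) : (cnotOp hab)ᴴ = cnotOp hab := by
  ext x y
  simp only [cnotOp, LocalOp.toOp, gateCNot, Matrix.conjTranspose_apply, Matrix.of_apply]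
  have key : ∀ s t u v : Fin 2, ((s, t) = (u, u + v)) ↔ ((u, v) = (s, s + t)) := by decide
  by_cases h : ∀ w, w ≠ a → w ≠ b → x w = y w
  · rw [if_pos h, if_pos fun w hw hb => (h w hw hb).symm]
    simp only [key (y a) (y b)]
    split_ifs <;> simp
  · rw [if_neg h, if_neg fun h' => h fun w hw hb => (h' w hw hb).symm, star_zero]

theorem cnotOp_mem_unitary {a b : W} (hab : a ≠ b) :
    cnotOp hab ∈ Matrix.unitaryGroup (W → Fin 2) ℂ := by
  rw [Matrix.mem_unitaryGroup_iff, Matrix.star_eq_conjTranspose, cnotOp_conjTranspose,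
    cnotOp_mul_self]

end LocalOperators

/-! ### Measurements and weights -/

section Measurements

variable {W : Type} [Fintype W] [DecidableEq W]

/-- Hermitian operators that square to the identity. -/
def IsObservable (M : Op W) : Prop := Mᴴ = M ∧ M * M = 1

/-- The sign of a measurement outcome. -/
def outcomeSign (s : Bool) : ℂ := if s then 1 else -1

theorem outcomeSign_eq (s : Bool) : outcomeSign s = 1 ∨ outcomeSign s = -1 := by
  cases s <;> simp [outcomeSign]

theorem star_outcomeSign (s : Bool) : star (outcomeSign s) = outcomeSign s := by
  cases s <;> simp [outcomeSign]

theorem proj_eq (M : Op W) (s : Bool) : proj M s = (2 : ℂ)⁻¹ • (1 + outcomeSign s • M) := rfl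

theorem IsObservable.proj_conjTranspose {M : Op W} (hM : IsObservable M) (s : Bool) :
    (proj M s)ᴴ = proj M s := by
  simp [proj_eq, Matrix.conjTranspose_smul, hM.1, star_outcomeSign]

theorem IsObservable.proj_mul_self {M : Op W} (hM : IsObservable M) (s : Bool) :
    proj M s * proj M s = proj M s := by
  simp only [proj_eq, smul_mul_assoc, mul_smul_comm, add_mul, mul_add, one_mul, mul_one, hM.2,
    smul_smul]
  rcases outcomeSign_eq s with h | h <;> rw [h] <;> module

theorem proj_true_add_proj_false (M : Op W) : proj M true + proj M false = 1 := by
  simp only [proj_eq, outcomeSign]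
  simp only [if_true, Bool.false_eq_true, if_false]
  module

/-- An observable `B` that anticommutes with `A` exchanges the two eigenspaces of `A`, so its
compression to either of them vanishes. Only the term `1/2` of the projector of `B` survives. -/
theorem proj_mul_proj_mul_proj {A B : Op W} (hA : IsObservable A) (hAB : A * B = -(B * A))
    (s t : Bool) : proj A s * (proj B t * proj A s) = (2 : ℂ)⁻¹ • proj A s := by
  have h1 : proj A s * (B * proj A s) = 0 := by
    simp only [proj_eq, smul_mul_assoc, mul_smul_comm, add_mul, mul_add, one_mul, mul_one,
      ← mul_assoc, hAB]
    simp only [neg_mul, mul_assoc, hA.2, mul_one, smul_neg, smul_add, smul_smul]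
    rcases outcomeSign_eq s with h | h <;> rw [h] <;> module
  have h2 : proj B t = (2 : ℂ)⁻¹ • (1 : Op W) + ((2 : ℂ)⁻¹ * outcomeSign t) • B := by
    rw [proj_eq]; module
  rw [h2, add_mul, mul_add, smul_mul_assoc, smul_mul_assoc, mul_smul_comm, mul_smul_comm, h1,
    one_mul, hA.proj_mul_self, smul_zero, add_zero]

theorem weight_nonneg (ψ : Ket W) : 0 ≤ weight ψ :=
  Finset.sum_nonneg fun _ _ => Complex.normSq_nonneg _

theorem weight_eq_dotProduct (ψ : Ket W) : (weight ψ : ℂ) = star ψ ⬝ᵥ ψ := by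
  simp [weight, dotProduct, Complex.normSq_eq_conj_mul_self]

theorem weight_mulVec (M : Op W) (ψ : Ket W) :
    (weight (M *ᵥ ψ) : ℂ) = star ψ ⬝ᵥ ((Mᴴ * M) *ᵥ ψ) := by
  rw [weight_eq_dotProduct, Matrix.star_mulVec, ← Matrix.dotProduct_mulVec, Matrix.mulVec_mulVec]

theorem IsObservable.weight_add {M : Op W} (hM : IsObservable M) (ψ : Ket W) :
    weight (proj M true *ᵥ ψ) + weight (proj M false *ᵥ ψ) = weight ψ := by
  have : ((weight (proj M true *ᵥ ψ) + weight (proj M false *ᵥ ψ) : ℝ) : ℂ) = weight ψ := by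
    rw [Complex.ofReal_add, weight_mulVec, weight_mulVec, hM.proj_conjTranspose,
      hM.proj_conjTranspose, hM.proj_mul_self, hM.proj_mul_self, ← dotProduct_add,
      ← Matrix.add_mulVec, proj_true_add_proj_false, Matrix.one_mulVec, weight_eq_dotProduct]
  exact_mod_cast this

/-- Measuring an observable that anticommutes with the one measured before, both outcomes have
probability one half. -/
theorem weight_proj_mul_proj {A B : Op W} (hA : IsObservable A) (hB : IsObservable B)
    (hAB : A * B = -(B * A)) (s t : Bool) (ψ : Ket W) :
    weight ((proj B t * proj A s) *ᵥ ψ) = weight (proj A s *ᵥ ψ) / 2 := by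
  have : (weight ((proj B t * proj A s) *ᵥ ψ) : ℂ) = ((weight (proj A s *ᵥ ψ) / 2 : ℝ) : ℂ) := by
    rw [weight_mulVec, Matrix.conjTranspose_mul, hA.proj_conjTranspose, hB.proj_conjTranspose,
      mul_assoc, ← mul_assoc (proj B t), hB.proj_mul_self, proj_mul_proj_mul_proj hA hAB,
      Matrix.smul_mulVec, dotProduct_smul]
    push_cast
    rw [weight_mulVec, hA.proj_conjTranspose, hA.proj_mul_self, smul_eq_mul]
    ring
  exact_mod_cast this

/-- The outcomes of a sequence of measurements have total probability one. -/
theorem sum_weight_measurements {k : ℕ} (M : Fin k → Op W) (hM : ∀ j, IsObservable (M j))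
    (ψ : Ket W) :
    ∑ o : Fin k → Bool, weight ((List.ofFn fun j => proj (M j) (o j)).reverse.prod *ᵥ ψ) =
      weight ψ := by
  induction k generalizing ψ with
  | zero => simp
  | succ k ih =>
    rw [← (Fin.consEquiv fun _ => Bool).sum_comp, Fintype.sum_prod_type]
    simp only [Fin.consEquiv_apply, List.ofFn_succ, Fin.cons_zero, Fin.cons_succ,
      List.reverse_cons, List.prod_append, List.prod_singleton, ← Matrix.mulVec_mulVec]
    simp only [ih (fun j => M j.succ) fun j => hM _]
    simp [(hM 0).weight_add]

end Measurements

/-! ### Pauli operators -/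

/-- The operator `X^x Z^z`. -/
def pauli (p : Bool × Bool) : Mat1 :=
  (if p.1 then pauliX else 1) * (if p.2 then pauliZ else 1)

theorem pauliX_conjTranspose : pauliXᴴ = pauliX := by
  ext i j; fin_cases i <;> fin_cases j <;> simp [pauliX]

theorem pauliZ_conjTranspose : pauliZᴴ = pauliZ := by
  ext i j; fin_cases i <;> fin_cases j <;> simp [pauliZ]

theorem pauliX_mul_self : pauliX * pauliX = 1 := by
  ext i j; fin_cases i <;> fin_cases j <;> simp [pauliX]

theorem pauliZ_mul_self : pauliZ * pauliZ = 1 := by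
  ext i j; fin_cases i <;> fin_cases j <;> simp [pauliZ]

theorem pauliX_mul_pauliZ : pauliX * pauliZ = -(pauliZ * pauliX) := by
  ext i j; fin_cases i <;> fin_cases j <;> simp [pauliX, pauliZ]

/-! ### The observables of the steps -/

section StepObservables

variable {n : ℕ}

theorem unitary_mul_conjTranspose (U : Matrix.unitaryGroup (Fin 2) ℂ) : U.1 * U.1ᴴ = 1 := by
  rw [← Matrix.star_eq_conjTranspose]; exact Matrix.mem_unitaryGroup_iff.1 U.2

theorem unitary_conjTranspose_mul (U : Matrix.unitaryGroup (Fin 2) ℂ) : U.1ᴴ * U.1 = 1 := by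
  rw [← Matrix.star_eq_conjTranspose]; exact Matrix.mem_unitaryGroup_iff'.1 U.2

theorem unitary_conj_mul (V : Matrix.unitaryGroup (Fin 2) ℂ) (A B : Mat1) :
    (V.1 * A * V.1ᴴ) * (V.1 * B * V.1ᴴ) = V.1 * (A * B) * V.1ᴴ := by
  simp only [Matrix.mul_assoc]
  rw [← Matrix.mul_assoc V.1ᴴ V.1, unitary_conjTranspose_mul, Matrix.one_mul]

theorem unitary_conj_mul' (U : Matrix.unitaryGroup (Fin 2) ℂ) (A B : Mat1) :
    (U.1ᴴ * A * U.1) * (U.1ᴴ * B * U.1) = U.1ᴴ * (A * B) * U.1 := by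
  simp only [Matrix.mul_assoc]
  rw [← Matrix.mul_assoc U.1 U.1ᴴ, unitary_mul_conjTranspose, Matrix.one_mul]

variable {W : Type} [Fintype W] [DecidableEq W]

theorem isObservable_onQubit (a : W) {M : Mat1} (h : Mᴴ = M) (h' : M * M = 1) :
    IsObservable (onQubit a M) :=
  ⟨by rw [onQubit_conjTranspose, h], by rw [← map_mul, h', map_one]⟩

theorem IsObservable.mul {A B : Op W} (hA : IsObservable A) (hB : IsObservable B)
    (hAB : Commute A B) : IsObservable (A * B) :=
  ⟨by rw [Matrix.conjTranspose_mul, hA.1, hB.1, hAB.eq],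
    by rw [mul_assoc, ← mul_assoc B, ← hAB.eq, mul_assoc A B B, hB.2, mul_one, hA.2]⟩

theorem anticommute_mul_left {A B C : Op W} (hAC : Commute A C) (h : C * B = -(B * C)) :
    C * (A * B) = -((A * B) * C) := by
  rw [← mul_assoc, ← hAC.eq, mul_assoc, h, mul_neg, mul_assoc]

theorem anticommute_mul_right {A B C : Op W} (hBC : Commute B C) (h : C * A = -(A * C)) :
    (A * B) * C = -(C * (A * B)) := by
  rw [mul_assoc, hBC.eq, ← mul_assoc, ← mul_assoc, h, neg_mul, neg_neg]

theorem isObservable_conj (a : W) (V : Matrix.unitaryGroup (Fin 2) ℂ) {M : Mat1} (h : Mᴴ = M)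
    (h' : M * M = 1) : IsObservable (onQubit a (V.1 * M * V.1ᴴ)) := by
  apply isObservable_onQubit
  · simp [Matrix.conjTranspose_mul, h, Matrix.mul_assoc]
  · rw [unitary_conj_mul, h', mul_one, unitary_mul_conjTranspose]

theorem isObservable_conj' (a : W) (U : Matrix.unitaryGroup (Fin 2) ℂ) {M : Mat1} (h : Mᴴ = M)
    (h' : M * M = 1) : IsObservable (onQubit a (U.1ᴴ * M * U.1)) := by
  apply isObservable_onQubit
  · simp [Matrix.conjTranspose_mul, h, Matrix.mul_assoc]
  · rw [unitary_conj_mul', h', mul_one, unitary_conjTranspose_mul]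

theorem placement_ne (e : Placement n) (i : Fin n) : e (some i) ≠ e none :=
  fun h => Option.some_ne_none i (e.injective h)

theorem Step.isObservable (e : Placement n) (s : Step n) (k : Fin s.arity) :
    IsObservable (s.obs e k).toOp := by
  have hX := pauliX_conjTranspose
  have hX' := pauliX_mul_self
  have hZ := pauliZ_conjTranspose
  have hZ' := pauliZ_mul_self
  cases s with
  | transfer i U V =>
    change Fin 3 at k
    fin_cases k
    · exact isObservable_conj _ V hX hX'
    · change IsObservable (LocalOp.two _ _ _ _).toOp
      rw [toOp_two_kronecker]
      exact (isObservable_conj' _ U hZ hZ').mul (isObservable_conj _ V hZ hZ')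
        (onQubit_commute (placement_ne e i) _ _)
    · exact isObservable_conj' _ U hX hX'
  | cnot i j hij =>
    change Fin 4 at k
    fin_cases k
    · exact isObservable_onQubit _ hZ hZ'
    · change IsObservable (LocalOp.two _ _ _ _).toOp
      rw [toOp_two_kronecker]
      exact (isObservable_onQubit _ hZ hZ').mul (isObservable_onQubit _ hX hX')
        (onQubit_commute (placement_ne e i) _ _)
    · change IsObservable (LocalOp.two _ _ _ _).toOp
      rw [toOp_two_kronecker]
      exact (isObservable_onQubit _ hZ hZ').mul (isObservable_onQubit _ hX hX')
        (onQubit_commute (placement_ne e j).symm _ _)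
    · exact isObservable_onQubit _ hX hX'

theorem Step.sum_weight_kraus (e : Placement n) (s : Step n) (ψ : Ket (Option (Fin n))) :
    ∑ o, weight (s.kraus e o *ᵥ ψ) = weight ψ :=
  sum_weight_measurements (fun k => (s.obs e k).toOp) (s.isObservable e) ψ

theorem prod_reverse_ofFn_three {M : Type*} [Monoid M] (f : Fin 3 → M) :
    (List.ofFn f).reverse.prod = f 2 * (f 1 * f 0) := by
  simp [List.ofFn_succ]

theorem prod_reverse_ofFn_four {M : Type*} [Monoid M] (f : Fin 4 → M) :
    (List.ofFn f).reverse.prod = f 3 * (f 2 * (f 1 * f 0)) := by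
  simp [List.ofFn_succ]

theorem Step.kraus_transfer (e : Placement n) (i : Fin n) (U V : Matrix.unitaryGroup (Fin 2) ℂ)
    (o : Fin 3 → Bool) :
    (Step.transfer i U V).kraus e o =
      proj (onQubit (e (some i)) (U.1ᴴ * pauliX * U.1)) (o 2) *
      (proj (onQubit (e (some i)) (U.1ᴴ * pauliZ * U.1) *
        onQubit (e none) (V.1 * pauliZ * V.1ᴴ)) (o 1) *
      proj (onQubit (e none) (V.1 * pauliX * V.1ᴴ)) (o 0)) := by
  rw [← toOp_two_kronecker (placement_ne e i), ← toOp_one, ← toOp_one]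
  exact prod_reverse_ofFn_three fun k : Fin 3 => proj (((Step.transfer i U V).obs e) k).toOp (o k)

theorem Step.kraus_cnot (e : Placement n) (i j : Fin n) (hij : i ≠ j) (o : Fin 4 → Bool) :
    (Step.cnot i j hij).kraus e o =
      proj (onQubit (e none) pauliX) (o 3) *
      (proj (onQubit (e none) pauliZ * onQubit (e (some j)) pauliX) (o 2) *
      (proj (onQubit (e (some i)) pauliZ * onQubit (e none) pauliX) (o 1) *
      proj (onQubit (e none) pauliZ) (o 0))) := by
  rw [← toOp_two_kronecker (placement_ne e i), ← toOp_two_kronecker (placement_ne e j).symm,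
    ← toOp_one, ← toOp_one]
  exact prod_reverse_ofFn_four fun k : Fin 4 => proj (((Step.cnot i j hij).obs e) k).toOp (o k)

/-- The error `X^x Z^z` of a state transfer with outcomes `o`. -/
def transferError (o : Fin 3 → Bool) : Bool × Bool := (!o 1, xor (o 0) (o 2))

/-- Each observable of a transfer anticommutes with the preceding one, so the second and third
outcomes are fair coins given the past. The first outcome need not be fair. -/
theorem weight_kraus_transfer (e : Placement n) (i : Fin n) (U V : Matrix.unitaryGroup (Fin 2) ℂ)
    (o : Fin 3 → Bool) (ψ : Ket (Option (Fin n))) :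
    weight ((Step.transfer i U V).kraus e o *ᵥ ψ) =
      weight (proj (onQubit (e none) (V.1 * pauliX * V.1ᴴ)) (o 0) *ᵥ ψ) / 4 := by
  have hX := pauliX_conjTranspose
  have hX' := pauliX_mul_self
  have hZ := pauliZ_conjTranspose
  have hZ' := pauliZ_mul_self
  have hc := onQubit_commute (placement_ne e i)
  have h1 := (isObservable_conj' (e (some i)) U hZ hZ').mul
    (isObservable_conj (e none) V hZ hZ') (hc _ _)
  have hanti0 := anticommute_mul_left (hc (U.1ᴴ * pauliZ * U.1) (V.1 * pauliX * V.1ᴴ))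
    (B := onQubit (e none) (V.1 * pauliZ * V.1ᴴ)) (by
      rw [← map_mul, ← map_mul, unitary_conj_mul, unitary_conj_mul, pauliX_mul_pauliZ]; simp)
  have hanti1 := anticommute_mul_right (hc (U.1ᴴ * pauliX * U.1) (V.1 * pauliZ * V.1ᴴ)).symm
    (A := onQubit (e (some i)) (U.1ᴴ * pauliZ * U.1)) (by
      rw [← map_mul, ← map_mul, unitary_conj_mul', unitary_conj_mul', pauliX_mul_pauliZ]; simp)
  rw [Step.kraus_transfer, ← Matrix.mulVec_mulVec, ← Matrix.mulVec_mulVec, Matrix.mulVec_mulVec,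
    weight_proj_mul_proj h1 (isObservable_conj' _ U hX hX') hanti1, Matrix.mulVec_mulVec,
    weight_proj_mul_proj (isObservable_conj _ V hX hX') h1 hanti0]
  ring

/-- Whatever the state of the register, each of the four errors of a state transfer has
probability one quarter. -/
theorem sum_weight_kraus_transfer (e : Placement n) (i : Fin n)
    (U V : Matrix.unitaryGroup (Fin 2) ℂ) (p : Bool × Bool) (ψ : Ket (Option (Fin n))) :
    ∑ o with transferError o = p, weight ((Step.transfer i U V).kraus e o *ᵥ ψ) =
      weight ψ / 4 := by
  have hX := isObservable_conj (e none) V pauliX_conjTranspose pauliX_mul_self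
  rw [← hX.weight_add ψ]
  simp only [weight_kraus_transfer]
  -- For each value of the first outcome, exactly one choice of the other two produces the error
  -- `p`. Summing over the first outcome therefore recovers the whole weight.
  have key : (Finset.univ.filter fun o : Fin 3 → Bool => transferError o = p) =
      {![true, !p.1, xor true p.2], ![false, !p.1, xor false p.2]} := by
    revert p; decide
  rw [key, Finset.sum_pair]
  · simp
    ring
  · intro h
    simpa using congrFun h 0

end StepObservables

/-! ### The action of the steps on the data -/

section StepAction

variable {n : ℕ}

theorem join_none (e : Placement n) (M : Mat1) (φ : Ket (Fin n)) (χ : Fin 2 → ℂ) :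
    onQubit (e none) M *ᵥ join e φ χ = join e φ (M *ᵥ χ) := by
  funext x
  rw [onQubit_mulVec]
  simp only [join, Matrix.mulVec, dotProduct, Finset.mul_sum]
  refine Finset.sum_congr rfl fun t _ => ?_
  have : (fun i => Function.update x (e none) t (e (some i))) = fun i => x (e (some i)) := by
    funext i
    rw [Function.update_of_ne (placement_ne e i)]
  rw [this, Function.update_self]
  ring

theorem update_comp_placement (e : Placement n) (i : Fin n) (x : Option (Fin n) → Fin 2)
    (t : Fin 2) : (fun j => Function.update x (e (some i)) t (e (some j))) =
      Function.update (fun j => x (e (some j))) i t := by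
  funext j
  by_cases h : j = i
  · subst h; simp
  · rw [Function.update_of_ne h, Function.update_of_ne]
    intro h'
    exact h (Option.some_injective _ (e.injective h'))

theorem join_some (e : Placement n) (i : Fin n) (M : Mat1) (φ : Ket (Fin n)) (χ : Fin 2 → ℂ) :
    onQubit (e (some i)) M *ᵥ join e φ χ = join e (onQubit i M *ᵥ φ) χ := by
  funext x
  simp only [onQubit_mulVec, join, Finset.sum_mul]
  refine Finset.sum_congr rfl fun t _ => ?_
  rw [update_comp_placement, Function.update_of_ne (placement_ne e i).symm]
  ring

/-- The step `s` with outcomes `o` applies `L` to the data, up to a scalar that depends only on the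
state of the auxiliary qubit. -/
def Step.Implements (s : Step n) (o : Fin s.arity → Bool) (L : Op (Fin n)) : Prop :=
  ∀ (e : Placement n) (χ : Fin 2 → ℂ), ∃ χ' : Fin 2 → ℂ, ∀ φ : Ket (Fin n),
    s.kraus e o *ᵥ join e φ χ = join (s.move e) (L *ᵥ φ) χ'

theorem join_smul_left (e : Placement n) (c : ℂ) (φ : Ket (Fin n)) (χ : Fin 2 → ℂ) :
    join e (c • φ) χ = join e φ (c • χ) := by
  funext x; simp [join]; ring

/-- A nonzero scalar can be moved from the data to the auxiliary qubit, so the applied operator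
matters only up to a scalar. -/
theorem Step.Implements.smul {s : Step n} {o : Fin s.arity → Bool} {L : Op (Fin n)}
    (h : s.Implements o L) {c : ℂ} (hc : c ≠ 0) : s.Implements o (c • L) := by
  intro e χ
  obtain ⟨χ', h'⟩ := h e χ
  refine ⟨c⁻¹ • χ', fun φ => ?_⟩
  rw [h', Matrix.smul_mulVec, join_smul_left, smul_smul, mul_inv_cancel₀ hc, one_smul]

theorem proj_mulVec {W : Type} [Fintype W] [DecidableEq W] (M : Op W) (s : Bool) (ψ : Ket W) :
    proj M s *ᵥ ψ = (2 : ℂ)⁻¹ • (ψ + outcomeSign s • (M *ᵥ ψ)) := by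
  rw [proj_eq, Matrix.smul_mulVec, Matrix.add_mulVec, Matrix.smul_mulVec, Matrix.one_mulVec]

theorem proj_mulVec_apply {W : Type} [Fintype W] [DecidableEq W] (M : Op W) (s : Bool) (ψ : Ket W)
    (x : W → Fin 2) :
    (proj M s *ᵥ ψ) x = 2⁻¹ * (ψ x + outcomeSign s * (M *ᵥ ψ) x) := by
  simp [proj_mulVec]

theorem proj_conj {W : Type} [Fintype W] [DecidableEq W] {C D : Op W} (hCD : C * D = 1) (M : Op W)
    (s : Bool) : proj (C * M * D) s = C * proj M s * D := by
  simp only [proj_eq, mul_smul_comm, smul_mul_assoc, mul_add, add_mul, mul_one, hCD]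

/-- The plain transfer is computed on amplitudes. Only the value of the transferred qubit in `φ`
matters, so the claim splits into finitely many cases: two physical bits and three outcomes. -/
theorem kraus_transfer_one_mulVec_join (e : Placement n) (i : Fin n) (o : Fin 3 → Bool)
    (φ : Ket (Fin n)) (χ : Fin 2 → ℂ) :
    (Step.transfer i 1 1).kraus e o *ᵥ join e φ χ =
      join ((Step.transfer i 1 1).move e) (onQubit i (pauli (transferError o)) *ᵥ φ)
        ((4⁻¹ * (if o 1 then 1 else outcomeSign (o 0)) * (χ 0 + outcomeSign (o 0) * χ 1)) •
          ![1, outcomeSign (o 2)]) := by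
  have hmove : ∀ x : Option (Fin n) → Fin 2,
      (fun j => x ((Step.transfer i 1 1).move e (some j))) =
        Function.update (fun j => x (e (some j))) i (x (e none)) := by
    intro x
    funext j
    by_cases h : j = i
    · subst h; simp [Step.move]
    · rw [Function.update_of_ne h]
      simp only [Step.move, Equiv.trans_apply]
      rw [Equiv.swap_apply_of_ne_of_ne] <;> simp [h]
  have hmove' : (Step.transfer i 1 1).move e none = e (some i) := by simp [Step.move]
  rw [Step.kraus_transfer]
  funext x
  simp only [OneMemClass.coe_one, Matrix.conjTranspose_one, one_mul, mul_one,
    ← Matrix.mulVec_mulVec, proj_mulVec_apply, onQubit_mulVec]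
  simp only [Fin.sum_univ_two, Function.update_self,
    Function.update_of_ne (placement_ne e i).symm, Function.update_idem, join,
    update_comp_placement, hmove, hmove', onQubit_mulVec]
  have hb : ∀ (x : Option (Fin n) → Fin 2) t,
      (fun j => Function.update x (e none) t (e (some j))) = fun j => x (e (some j)) := by
    intro x t
    funext j
    rw [Function.update_of_ne (placement_ne e j)]
  simp only [hb, update_comp_placement]
  have hφ : φ (fun j => x (e (some j))) =
      φ (Function.update (fun j => x (e (some j))) i (x (e (some i)))) := by
    rw [Function.update_eq_self_iff.2 rfl]
  rw [hφ]
  generalize (fun j => x (e (some j))) = y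
  generalize x (e none) = β
  generalize x (e (some i)) = α
  generalize h0 : φ (Function.update y i 0) = f0
  generalize h1 : φ (Function.update y i 1) = f1
  have hα : φ (Function.update y i α) = if α = 0 then f0 else f1 := by
    fin_cases α <;> simp [h0, h1]
  rw [hα]
  simp only [transferError]
  generalize o 0 = s0
  generalize o 1 = s1
  generalize o 2 = s2
  fin_cases α <;> fin_cases β <;> cases s0 <;> cases s1 <;> cases s2 <;>
    simp [pauliX, pauliZ, pauli, outcomeSign] <;> ring

/-- All three observables are the plain ones conjugated by the same unitary, `U†` on the source
qubit and `V` on the auxiliary one. The inner conjugations cancel in the product of projectors. -/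
theorem kraus_transfer_conj (e : Placement n) (i : Fin n) (U V : Matrix.unitaryGroup (Fin 2) ℂ)
    (o : Fin 3 → Bool) :
    (Step.transfer i U V).kraus e o =
      (onQubit (e (some i)) U.1ᴴ * onQubit (e none) V.1) * (Step.transfer i 1 1).kraus e o *
        (onQubit (e (some i)) U.1 * onQubit (e none) V.1ᴴ) := by
  have hc := onQubit_commute (placement_ne e i)
  set C := onQubit (e (some i)) U.1ᴴ * onQubit (e none) V.1 with hC
  set D := onQubit (e (some i)) U.1 * onQubit (e none) V.1ᴴ with hD
  have hmul : ∀ A B A' B' : Mat1, (onQubit (e (some i)) A * onQubit (e none) B) *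
      (onQubit (e (some i)) A' * onQubit (e none) B') =
      onQubit (e (some i)) (A * A') * onQubit (e none) (B * B') := by
    intro A B A' B'
    rw [map_mul, map_mul, mul_assoc, ← mul_assoc (onQubit (e none) B), ← (hc A' B).eq]
    simp only [mul_assoc]
  have hCD : C * D = 1 := by
    rw [hC, hD, hmul, unitary_conjTranspose_mul, unitary_mul_conjTranspose, map_one, map_one,
      one_mul]
  have hDC : D * C = 1 := by
    rw [hC, hD, hmul, unitary_conjTranspose_mul, unitary_mul_conjTranspose, map_one, map_one,
      one_mul]
  have h3 : ∀ A B : Mat1, C * (onQubit (e (some i)) A * onQubit (e none) B) * D =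
      onQubit (e (some i)) (U.1ᴴ * A * U.1) * onQubit (e none) (V.1 * B * V.1ᴴ) := by
    intro A B
    rw [hC, hD, hmul, hmul]
  have hX2 : onQubit (e (some i)) (U.1ᴴ * pauliX * U.1) =
      C * onQubit (e (some i)) pauliX * D := by
    have := h3 pauliX 1
    rw [mul_one, unitary_mul_conjTranspose, map_one, mul_one, mul_one] at this
    exact this.symm
  have hX0 : onQubit (e none) (V.1 * pauliX * V.1ᴴ) = C * onQubit (e none) pauliX * D := by
    have := h3 1 pauliX
    rw [mul_one, unitary_conjTranspose_mul, map_one, one_mul, one_mul] at this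
    exact this.symm
  rw [Step.kraus_transfer, Step.kraus_transfer, hX2, hX0, ← h3, proj_conj hCD, proj_conj hCD,
    proj_conj hCD]
  simp only [OneMemClass.coe_one, Matrix.conjTranspose_one, one_mul, mul_one]
  generalize proj (onQubit (e (some i)) pauliX) (o 2) = P2
  generalize proj (onQubit (e none) pauliX) (o 0) = P0
  generalize proj (onQubit (e (some i)) pauliZ * onQubit (e none) pauliZ) (o 1) = P1
  calc C * P2 * D * (C * P1 * D * (C * P0 * D))
      = C * P2 * (D * C) * P1 * (D * C) * P0 * D := by simp only [mul_assoc]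
    _ = C * (P2 * (P1 * P0)) * D := by simp only [hDC, mul_one, mul_assoc]

/-- The generalised state transfer applies `V σ U` to the data, where `σ` is a Pauli operator that
depends on the outcomes. -/
theorem Step.implements_transfer (i : Fin n) (U V : Matrix.unitaryGroup (Fin 2) ℂ)
    (o : Fin 3 → Bool) :
    (Step.transfer i U V).Implements o (onQubit i (V.1 * pauli (transferError o) * U.1)) := by
  intro e χ
  -- The conjugation feeds `V† χ` to the plain transfer as auxiliary state. Afterwards the source
  -- qubit is the auxiliary one, so the remaining `U†` acts on the new auxiliary state and `V` on
  -- the data.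
  refine ⟨U.1ᴴ *ᵥ ((4⁻¹ * (if o 1 then 1 else outcomeSign (o 0)) *
    ((V.1ᴴ *ᵥ χ) 0 + outcomeSign (o 0) * (V.1ᴴ *ᵥ χ) 1)) • ![1, outcomeSign (o 2)]), fun φ => ?_⟩
  have h1 : e (some i) = (Step.transfer i 1 1).move e none := by simp [Step.move]
  have h2 : e none = (Step.transfer i 1 1).move e (some i) := by simp [Step.move]
  rw [kraus_transfer_conj, ← Matrix.mulVec_mulVec, ← Matrix.mulVec_mulVec,
    ← Matrix.mulVec_mulVec, ← Matrix.mulVec_mulVec, join_none, join_some,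
    kraus_transfer_one_mulVec_join, h2, join_some, h1, join_none, map_mul, map_mul,
    ← Matrix.mulVec_mulVec, ← Matrix.mulVec_mulVec]
  rfl

/-- This expands `(1 + Z)/2 + X (1 - Z)/2`, with `Z` on the control and `X` on the target: the
identity or `X`, according to the value of the control. -/
theorem cnotOp_eq {W : Type} [Fintype W] [DecidableEq W] {a b : W} (hab : a ≠ b) :
    cnotOp hab = (2 : ℂ)⁻¹ • (1 + onQubit a pauliZ + onQubit b pauliX -
      onQubit b pauliX * onQubit a pauliZ) := by
  apply Op.ext_mulVec
  intro ψ x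
  rw [Matrix.smul_mulVec, Matrix.sub_mulVec, Matrix.add_mulVec, Matrix.add_mulVec,
    Matrix.one_mulVec, ← Matrix.mulVec_mulVec, cnotOp_mulVec]
  simp only [Pi.smul_apply, Pi.sub_apply, Pi.add_apply, onQubit_mulVec, Fin.sum_univ_two,
    Function.update_of_ne hab]
  have ha : ∀ y : W → Fin 2, ψ (Function.update y a (y a)) = ψ y := fun y => by simp
  have hb : ψ (Function.update x b (x b)) = ψ x := by simp
  have h1 := ha x
  have h2 := fun t => ha (Function.update x b t)
  simp only [Function.update_of_ne hab] at h2
  generalize x a = α at *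
  generalize x b = β at *
  fin_cases α <;> fin_cases β <;> simp [pauliX, pauliZ] at h1 h2 hb ⊢ <;>
    simp only [h1, h2, hb] <;> ring

/-- The controlled-not followed by Pauli operators. -/
theorem pauli_mul_cnotOp {i j : Fin n} (hij : i ≠ j) (p q : Bool) :
    onQubit i (pauli (false, !q)) * onQubit j (pauli (!p, false)) * cnotOp hij =
      ((if !q && !p then (-1 : ℂ) else 1) * 2⁻¹) • (1 + outcomeSign p • onQubit i pauliZ +
        outcomeSign q • onQubit j pauliX -
        (outcomeSign p * outcomeSign q) • (onQubit j pauliX * onQubit i pauliZ)) := by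
  have hZ : onQubit i pauliZ * onQubit i pauliZ = 1 := by rw [← map_mul, pauliZ_mul_self, map_one]
  have hX : onQubit j pauliX * onQubit j pauliX = 1 := by rw [← map_mul, pauliX_mul_self, map_one]
  have hc := (onQubit_commute hij pauliZ pauliX).eq
  rw [cnotOp_eq]
  have e2 : ∀ M : Op (Fin n), onQubit j pauliX * (onQubit j pauliX * M) = M := fun M => by
    rw [← mul_assoc, hX, one_mul]
  have e3 : ∀ M : Op (Fin n), onQubit i pauliZ * (onQubit j pauliX * M) =
      onQubit j pauliX * (onQubit i pauliZ * M) := fun M => by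
    rw [← mul_assoc, hc, mul_assoc]
  cases p <;> cases q <;>
    simp [pauli, outcomeSign, mul_add, mul_sub, mul_assoc, hZ, hX, hc, e2, e3] <;> module

-- Measuring `Z` first and `X` last fixes the auxiliary qubit at both ends. Expanding the two middle
-- projectors leaves `1`, `Z` on the control, `X` on the target and their product. Since `Z` and `X`
-- anticommute on the auxiliary qubit, the product term gets the relative minus sign of a
-- controlled-not.
set_option maxHeartbeats 1000000 in
theorem kraus_cnot_mulVec_join (e : Placement n) (i j : Fin n) (hij : i ≠ j) (o : Fin 4 → Bool)
    (φ : Ket (Fin n)) (χ : Fin 2 → ℂ) :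
    (Step.cnot i j hij).kraus e o *ᵥ join e φ χ =
      join e ((1 + outcomeSign (!xor (o 1) (o 3)) • onQubit i pauliZ +
        outcomeSign (!xor (o 0) (o 2)) • onQubit j pauliX -
        (outcomeSign (!xor (o 1) (o 3)) * outcomeSign (!xor (o 0) (o 2))) •
          (onQubit j pauliX * onQubit i pauliZ)) *ᵥ φ)
        ((8⁻¹ * (if o 0 then χ 0 else outcomeSign (o 3) * χ 1)) • ![1, outcomeSign (o 3)]) := by
  rw [Step.kraus_cnot]
  simp only [← Matrix.mulVec_mulVec, proj_mulVec, Matrix.mulVec_add, Matrix.mulVec_smul,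
    join_none, join_some, Matrix.add_mulVec, Matrix.sub_mulVec, Matrix.smul_mulVec,
    Matrix.one_mulVec]
  funext x
  simp only [join, Pi.add_apply, Pi.smul_apply, Pi.sub_apply, smul_eq_mul]
  generalize (fun i => x (e (some i))) = y
  generalize φ y = A
  generalize (onQubit j pauliX *ᵥ onQubit i pauliZ *ᵥ φ) y = D
  generalize (onQubit j pauliX *ᵥ φ) y = C
  generalize (onQubit i pauliZ *ᵥ φ) y = B
  generalize x (e none) = γ
  generalize o 0 = s0
  generalize o 1 = s1
  generalize o 2 = s2
  generalize o 3 = s3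
  fin_cases γ <;> cases s0 <;> cases s1 <;> cases s2 <;> cases s3 <;>
    simp [pauliX, pauliZ, outcomeSign, Matrix.mulVec, dotProduct, Fin.sum_univ_two] <;> ring

/-- The `CNot` step applies a controlled-not to the data, followed by Pauli operators that depend
on the outcomes. -/
theorem Step.implements_cnot {i j : Fin n} (hij : i ≠ j) (o : Fin 4 → Bool) :
    (Step.cnot i j hij).Implements o (onQubit i (pauli (false, xor (o 0) (o 2))) *
      onQubit j (pauli (xor (o 1) (o 3), false)) * cnotOp hij) := by
  have h := pauli_mul_cnotOp hij (!xor (o 1) (o 3)) (!xor (o 0) (o 2))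
  rw [Bool.not_not, Bool.not_not] at h
  rw [h]
  apply Step.Implements.smul
  · intro e χ
    exact ⟨_, fun φ => kraus_cnot_mulVec_join e i j hij o φ χ⟩
  · split_ifs <;> norm_num

end StepAction

/-! ### Halting of automata -/

namespace Automaton

variable {n : ℕ}

theorem haltWeight_of_halting (A : Automaton n) {q : A.State} (h : A.action q = none) (N : ℕ)
    (e : Placement n) (ψ : Ket (Option (Fin n))) : A.haltWeight N q e ψ = weight ψ := by
  cases N <;> simp [haltWeight, h]

theorem haltWeight_zero_of_step (A : Automaton n) {q : A.State} {a} (h : A.action q = some a)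
    (e : Placement n) (ψ : Ket (Option (Fin n))) : A.haltWeight 0 q e ψ = 0 := by
  simp [haltWeight, h]

theorem haltWeight_succ_of_step (A : Automaton n) {q : A.State} {s : Step n}
    {next : (Fin s.arity → Bool) → A.State} (h : A.action q = some ⟨s, next⟩) (N : ℕ)
    (e : Placement n) (ψ : Ket (Option (Fin n))) :
    A.haltWeight (N + 1) q e ψ =
      ∑ o, A.haltWeight N (next o) (s.move e) (s.kraus e o *ᵥ ψ) := by
  simp [haltWeight, h]

theorem haltWeight_nonneg (A : Automaton n) (N : ℕ) (q : A.State) (e : Placement n)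
    (ψ : Ket (Option (Fin n))) : 0 ≤ A.haltWeight N q e ψ := by
  induction N generalizing q e ψ with
  | zero =>
    rcases h : A.action q with _ | a
    · rw [A.haltWeight_of_halting h]; exact weight_nonneg ψ
    · rw [A.haltWeight_zero_of_step h]
  | succ N ih =>
    rcases h : A.action q with _ | ⟨s, next⟩
    · rw [A.haltWeight_of_halting h]; exact weight_nonneg ψ
    · rw [A.haltWeight_succ_of_step h]
      exact Finset.sum_nonneg fun o _ => ih _ _ _

theorem haltWeight_le_weight (A : Automaton n) (N : ℕ) (q : A.State) (e : Placement n)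
    (ψ : Ket (Option (Fin n))) : A.haltWeight N q e ψ ≤ weight ψ := by
  induction N generalizing q e ψ with
  | zero =>
    rcases h : A.action q with _ | a
    · rw [A.haltWeight_of_halting h]
    · rw [A.haltWeight_zero_of_step h]; exact weight_nonneg ψ
  | succ N ih =>
    rcases h : A.action q with _ | ⟨s, next⟩
    · rw [A.haltWeight_of_halting h]
    · rw [A.haltWeight_succ_of_step h, ← s.sum_weight_kraus e ψ]
      exact Finset.sum_le_sum fun o _ => ih _ _ _

theorem haltWeight_mono (A : Automaton n) (q : A.State) (e : Placement n)
    (ψ : Ket (Option (Fin n))) : Monotone fun N => A.haltWeight N q e ψ := by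
  apply monotone_nat_of_le_succ
  intro N
  induction N generalizing q e ψ with
  | zero =>
    rcases h : A.action q with _ | a
    · rw [A.haltWeight_of_halting h, A.haltWeight_of_halting h]
    · rw [A.haltWeight_zero_of_step h]; exact A.haltWeight_nonneg _ _ _ _
  | succ N ih =>
    rcases h : A.action q with _ | ⟨s, next⟩
    · rw [A.haltWeight_of_halting h, A.haltWeight_of_halting h]
    · rw [A.haltWeight_succ_of_step h, A.haltWeight_succ_of_step h]
      exact Finset.sum_le_sum fun o _ => ih _ _ _

/-- From every state, and whatever the state of the register, the automaton halts within a bounded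
number of steps with a probability bounded below. -/
def HaltsUniformly (A : Automaton n) : Prop :=
  ∃ (N : ℕ) (δ : ℝ), 0 < δ ∧
    ∀ (q : A.State) (e : Placement n) (ψ : Ket (Option (Fin n))),
      δ * weight ψ ≤ A.haltWeight N q e ψ

/-- The weight that has not halted after `N` steps is a sum over runs, and the bound `hM`, uniform
in the state and the placement, applies to the end of each run. -/
theorem weight_sub_haltWeight_add_le (A : Automaton n) {M : ℕ} {c : ℝ}
    (hM : ∀ q e ψ, weight ψ - A.haltWeight M q e ψ ≤ c * weight ψ) (N : ℕ) (q : A.State)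
    (e : Placement n) (ψ : Ket (Option (Fin n))) :
    weight ψ - A.haltWeight (N + M) q e ψ ≤ c * (weight ψ - A.haltWeight N q e ψ) := by
  induction N generalizing q e ψ with
  | zero =>
    rcases h : A.action q with _ | a
    · simp [A.haltWeight_of_halting h]
    · simpa [A.haltWeight_zero_of_step h] using hM q e ψ
  | succ N ih =>
    rcases h : A.action q with _ | ⟨s, next⟩
    · simp [A.haltWeight_of_halting h]
    · rw [show N + 1 + M = N + M + 1 by ring, A.haltWeight_succ_of_step h,
        A.haltWeight_succ_of_step h, ← s.sum_weight_kraus e ψ, ← Finset.sum_sub_distrib,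
        ← Finset.sum_sub_distrib, Finset.mul_sum]
      exact Finset.sum_le_sum fun o _ => ih _ _ _

/-- Every block of `M` steps multiplies the weight that has not halted by at most `1 - δ`.
Monotonicity extends the limit from multiples of `M` to all step counts. -/
theorem HaltsUniformly.tendsto {A : Automaton n} (hA : A.HaltsUniformly) (q : A.State)
    (e : Placement n) (ψ : Ket (Option (Fin n))) :
    Filter.Tendsto (fun N => A.haltWeight N q e ψ) Filter.atTop (𝓝 (weight ψ)) := by
  obtain ⟨M, δ, hδ, hM⟩ := hA
  wlog hδ1 : δ ≤ 1 generalizing δ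
  · refine this 1 one_pos (fun q e ψ => ?_) le_rfl
    refine le_trans ?_ (hM q e ψ)
    exact mul_le_mul_of_nonneg_right (not_le.1 hδ1).le (weight_nonneg ψ)
  have hgeom : ∀ k : ℕ, weight ψ - A.haltWeight (k * M) q e ψ ≤ (1 - δ) ^ k * weight ψ := by
    intro k
    induction k with
    | zero =>
      have := A.haltWeight_nonneg (0 * M) q e ψ
      simp only [pow_zero, one_mul]
      linarith
    | succ k ih =>
      have h := A.weight_sub_haltWeight_add_le (M := M) (c := 1 - δ)
        (fun q e ψ => by linarith [hM q e ψ]) (k * M) q e ψ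
      rw [show (k + 1) * M = k * M + M by ring, pow_succ]
      refine h.trans ?_
      have := mul_le_mul_of_nonneg_left ih (sub_nonneg.2 hδ1)
      linarith
  have hlim : Filter.Tendsto (fun k : ℕ => weight ψ - (1 - δ) ^ k * weight ψ) Filter.atTop
      (𝓝 (weight ψ)) := by
    have := ((tendsto_pow_atTop_nhds_zero_of_lt_one (sub_nonneg.2 hδ1)
      (by linarith : 1 - δ < 1)).mul_const (weight ψ)).const_sub (weight ψ)
    simpa using this
  refine tendsto_order.2 ⟨fun a ha => ?_, fun a ha => ?_⟩
  · obtain ⟨k, hk⟩ := ((tendsto_order.1 hlim).1 a ha).exists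
    filter_upwards [Filter.eventually_ge_atTop (k * M)] with N hN
    have := A.haltWeight_mono q e ψ hN
    simp only at this
    linarith [hgeom k]
  · exact Filter.Eventually.of_forall fun N => (A.haltWeight_le_weight N q e ψ).trans_lt ha

/-! ### Correctness of automata -/

/-- The invariant `inv` proves that the automaton applies `U` to the data: in the state `q`, the
operator `inv q` has been applied. -/
structure Realizes (A : Automaton n) (U : Op (Fin n)) (inv : A.State → Op (Fin n)) : Prop where
  start : inv A.start = 1
  step : ∀ q s next, A.action q = some ⟨s, next⟩ → ∀ o, ∃ L, s.Implements o L ∧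
    inv (next o) = L * inv q
  halt : ∀ q, A.action q = none → ∃ c : ℂ, c ≠ 0 ∧ inv q = c • U

theorem Realizes.simulates {A : Automaton n} {U : Op (Fin n)} {inv : A.State → Op (Fin n)}
    (h : A.Realizes U inv) (hA : A.HaltsUniformly) : A.Simulates U := by
  refine ⟨fun φ χ => hA.tendsto _ _ _, fun q e K hK hq χ => ?_⟩
  -- The invariant holds along every branch, by induction on the branch. The auxiliary state absorbs
  -- the scalars and never depends on `φ`.
  have key : ∃ χ' : Fin 2 → ℂ, ∀ φ : Ket (Fin n),
      K *ᵥ join (Equiv.refl _) φ χ = join e (inv q *ᵥ φ) χ' := by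
    clear hq
    induction hK with
    | init => exact ⟨χ, fun φ => by rw [h.start, Matrix.one_mulVec, Matrix.one_mulVec]⟩
    | step o _ hq ih =>
      obtain ⟨χ₁, h₁⟩ := ih
      obtain ⟨L, hL, hinv⟩ := h.step _ _ _ hq o
      obtain ⟨χ₂, h₂⟩ := hL _ χ₁
      exact ⟨χ₂, fun φ => by
        rw [← Matrix.mulVec_mulVec, h₁, h₂, hinv, Matrix.mulVec_mulVec]⟩
  obtain ⟨χ', h'⟩ := key
  obtain ⟨c, -, hc⟩ := h.halt q hq
  exact ⟨c • χ', fun φ => by rw [h', hc, Matrix.smul_mulVec, join_smul_left]⟩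

/-! ### Composition of automata -/

/-- A step with renamed next states. -/
def mapAction {S T : Type} (f : S → T) (a : Σ s : Step n, (Fin s.arity → Bool) → S) :
    Σ s : Step n, (Fin s.arity → Bool) → T := ⟨a.1, fun o => f (a.2 o)⟩

theorem haltWeight_map {A B : Automaton n} (f : B.State → A.State)
    (hf : ∀ q, A.action (f q) = (B.action q).map (mapAction f)) (N : ℕ) (q : B.State)
    (e : Placement n) (ψ : Ket (Option (Fin n))) :
    A.haltWeight N (f q) e ψ = B.haltWeight N q e ψ := by
  induction N generalizing q e ψ with
  | zero =>
    rcases h : B.action q with _ | a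
    · rw [B.haltWeight_of_halting h, A.haltWeight_of_halting (by rw [hf, h]; rfl)]
    · rw [B.haltWeight_zero_of_step h, A.haltWeight_zero_of_step (by rw [hf, h]; rfl)]
  | succ N ih =>
    rcases h : B.action q with _ | ⟨s, next⟩
    · rw [B.haltWeight_of_halting h, A.haltWeight_of_halting (by rw [hf, h]; rfl)]
    · rw [B.haltWeight_succ_of_step h,
        A.haltWeight_succ_of_step (s := s) (next := fun o => f (next o)) (by rw [hf, h]; rfl)]
      exact Finset.sum_congr rfl fun o _ => ih _ _ _

theorem haltWeight_congr (A : Automaton n) {q q' : A.State} (h : A.action q = A.action q') (N : ℕ)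
    (e : Placement n) (ψ : Ket (Option (Fin n))) :
    A.haltWeight N q e ψ = A.haltWeight N q' e ψ := by
  cases N <;> simp [haltWeight, h]

theorem map_mapAction_eq_some {S T : Type} {f : S → T}
    {x : Option (Σ s : Step n, (Fin s.arity → Bool) → S)} {s : Step n}
    {next : (Fin s.arity → Bool) → T} (h : x.map (mapAction f) = some ⟨s, next⟩) :
    ∃ next', x = some ⟨s, next'⟩ ∧ next = fun o => f (next' o) := by
  rcases x with _ | ⟨s', next'⟩
  · simp at h
  · simp only [Option.map_some, mapAction, Option.some.injEq] at h
    cases h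
    exact ⟨next', rfl, rfl⟩

/-- The automaton that runs `A` and then `B`. -/
def seq (A B : Automaton n) : Automaton n where
  State := A.State ⊕ B.State
  finite := by
    have := A.finite
    have := B.finite
    infer_instance
  start := Sum.inl A.start
  action
    | Sum.inl q =>
      match A.action q with
      | some a => some (mapAction Sum.inl a)
      -- Every transition must be a step of simulation, so there is no idle move to the start of
      -- `B`: a halting state of `A` takes over the first action of `B`, and still halts if `B`
      -- halts at once.
      | none => (B.action B.start).map (mapAction Sum.inr)
    | Sum.inr q => (B.action q).map (mapAction Sum.inr)

theorem seq_action_inl_some (A B : Automaton n) {q : A.State} {a} (h : A.action q = some a) :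
    (A.seq B).action (Sum.inl q) = some (mapAction Sum.inl a) := by
  simp [seq, h]

theorem seq_action_inl_none (A B : Automaton n) {q : A.State} (h : A.action q = none) :
    (A.seq B).action (Sum.inl q) = (B.action B.start).map (mapAction Sum.inr) := by
  simp [seq, h]

theorem UsesOnly.seq {A B : Automaton n} {O : Family} (hA : A.UsesOnly O) (hB : B.UsesOnly O) :
    (A.seq B).UsesOnly O := by
  rintro (q | q) s next h
  · rcases hq : A.action q with _ | ⟨s', next'⟩
    · rw [seq_action_inl_none A B hq] at h
      obtain ⟨next', h', -⟩ := map_mapAction_eq_some h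
      exact hB _ _ _ h'
    · rw [seq_action_inl_some A B hq] at h
      simp only [mapAction] at h
      cases h
      exact hA _ _ _ hq
  · obtain ⟨next', h', -⟩ := map_mapAction_eq_some h
    exact hB _ _ _ h'

theorem HaltsUniformly.seq {A B : Automaton n} (hA : A.HaltsUniformly) (hB : B.HaltsUniformly) :
    (A.seq B).HaltsUniformly := by
  obtain ⟨NA, δA, hδA, hA⟩ := hA
  obtain ⟨NB, δB, hδB, hB⟩ := hB
  have hinr : ∀ N (q : B.State) e ψ,
      (A.seq B).haltWeight N (Sum.inr q) e ψ = B.haltWeight N q e ψ :=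
    haltWeight_map (A := A.seq B) (B := B) Sum.inr fun q => rfl
  have hinl : ∀ N (q : A.State) e ψ,
      δB * A.haltWeight N q e ψ ≤ (A.seq B).haltWeight (N + NB) (Sum.inl q) e ψ := by
    have hhalt : ∀ N (q : A.State) e ψ, A.action q = none →
        δB * A.haltWeight N q e ψ ≤ (A.seq B).haltWeight (N + NB) (Sum.inl q) e ψ := by
      intro N q e ψ h
      rw [A.haltWeight_of_halting h, (A.seq B).haltWeight_congr
        (q' := Sum.inr B.start) (seq_action_inl_none A B h), hinr]
      exact (hB _ e ψ).trans (B.haltWeight_mono _ e ψ (Nat.le_add_left NB N))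
    intro N
    induction N with
    | zero =>
      intro q e ψ
      rcases h : A.action q with _ | a
      · exact hhalt _ _ _ _ h
      · rw [A.haltWeight_zero_of_step h, mul_zero]
        exact haltWeight_nonneg _ _ _ _ _
    | succ N ih =>
      intro q e ψ
      rcases h : A.action q with _ | ⟨s, next⟩
      · exact hhalt _ _ _ _ h
      · rw [A.haltWeight_succ_of_step h, show N + 1 + NB = N + NB + 1 by ring,
          (A.seq B).haltWeight_succ_of_step (seq_action_inl_some A B h), Finset.mul_sum]
        exact Finset.sum_le_sum fun o _ => ih _ _ _
  -- The bound must hold from every state. Runs starting inside `B` only need `δB`, which may be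
  -- smaller than `δB * δA` because `δA` is not assumed to be at most 1.
  refine ⟨NA + NB, min (δB * δA) δB, lt_min (mul_pos hδB hδA) hδB, ?_⟩
  rintro (q | q) e ψ
  · calc min (δB * δA) δB * weight ψ ≤ δB * δA * weight ψ :=
          mul_le_mul_of_nonneg_right (min_le_left _ _) (weight_nonneg ψ)
      _ = δB * (δA * weight ψ) := by ring
      _ ≤ δB * A.haltWeight NA q e ψ := mul_le_mul_of_nonneg_left (hA q e ψ) hδB.le
      _ ≤ _ := hinl NA q e ψ
  · rw [hinr]
    calc min (δB * δA) δB * weight ψ ≤ δB * weight ψ :=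
          mul_le_mul_of_nonneg_right (min_le_right _ _) (weight_nonneg ψ)
      _ ≤ B.haltWeight NB q e ψ := hB q e ψ
      _ ≤ _ := B.haltWeight_mono _ e ψ (Nat.le_add_left NB NA)

theorem Realizes.seq {A B : Automaton n} {U V : Op (Fin n)} {invA : A.State → Op (Fin n)}
    {invB : B.State → Op (Fin n)} (hA : A.Realizes U invA) (hB : B.Realizes V invB) :
    (A.seq B).Realizes (V * U) (Sum.elim invA fun q => invB q * U) where
  start := hA.start
  step := by
    rintro (q | q) s next h o
    · rcases hq : A.action q with _ | ⟨s', next'⟩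
      · rw [seq_action_inl_none A B hq] at h
        obtain ⟨next', h', rfl⟩ := map_mapAction_eq_some h
        obtain ⟨L, hL, hinv⟩ := hB.step _ _ _ h' o
        obtain ⟨c, hc, hU⟩ := hA.halt q hq
        -- Here `A` has applied `c • U`, whereas the invariant on the states of `B` is normalised to
        -- start from `U`. The scalar is absorbed into the first step of `B`.
        refine ⟨c⁻¹ • L, hL.smul (inv_ne_zero hc), ?_⟩
        simp only [Sum.elim_inl, Sum.elim_inr]
        rw [hinv, hB.start, hU, smul_mul_smul_comm, inv_mul_cancel₀ hc, one_smul, mul_one]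
      · rw [seq_action_inl_some A B hq] at h
        simp only [mapAction] at h
        cases h
        exact hA.step _ _ _ hq o
    · obtain ⟨next', h', rfl⟩ := map_mapAction_eq_some h
      obtain ⟨L, hL, hinv⟩ := hB.step _ _ _ h' o
      exact ⟨L, hL, by simp only [Sum.elim_inr]; rw [hinv, mul_assoc]⟩
  halt := by
    rintro (q | q) h
    · rcases hq : A.action q with _ | a
      · rw [seq_action_inl_none A B hq] at h
        replace h := Option.map_eq_none_iff.1 h
        obtain ⟨c, hc, hU⟩ := hA.halt q hq
        obtain ⟨d, hd, hV⟩ := hB.halt _ h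
        -- Both automata halt without a further step, so `V` is itself a multiple of the identity.
        refine ⟨c * d, mul_ne_zero hc hd, ?_⟩
        rw [hB.start] at hV
        rw [Sum.elim_inl, hU, mul_smul, ← smul_mul_assoc d, ← hV, one_mul]
      · rw [seq_action_inl_some A B hq] at h
        simp at h
    · have h' : B.action q = none := Option.map_eq_none_iff.1 h
      obtain ⟨d, hd, hV⟩ := hB.halt _ h'
      exact ⟨d, hd, by rw [Sum.elim_inr, hV, smul_mul_assoc]⟩

/-- The automaton that performs the step `s` and then runs the automaton chosen by the outcomes. -/
def stepThen (s : Step n) (B : (Fin s.arity → Bool) → Automaton n) : Automaton n where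
  State := Option (Σ o, (B o).State)
  finite := by
    have := fun o => (B o).finite
    infer_instance
  start := none
  action
    | none => some ⟨s, fun o => some ⟨o, (B o).start⟩⟩
    | some q => ((B q.1).action q.2).map (mapAction fun q' => some ⟨q.1, q'⟩)

theorem UsesOnly.stepThen {s : Step n} {B : (Fin s.arity → Bool) → Automaton n} {O : Family}
    (hs : ∀ (e : Placement n) (k : Fin s.arity), (s.obs e k).MemFamily O)
    (hB : ∀ o, (B o).UsesOnly O) : (stepThen s B).UsesOnly O := by
  rintro (_ | ⟨o, q⟩) s' next h
  · simp only [Automaton.stepThen, Option.some.injEq] at h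
    cases h
    exact hs
  · obtain ⟨next', h', -⟩ := map_mapAction_eq_some h
    exact hB _ _ _ _ h'

/-- There are finitely many outcome tuples, so the smallest `δ` and the sum of the bounds `N` serve
all branches; halting weight is monotone in the number of steps. -/
theorem HaltsUniformly.stepThen {s : Step n} {B : (Fin s.arity → Bool) → Automaton n}
    (hB : ∀ o, (B o).HaltsUniformly) : (stepThen s B).HaltsUniformly := by
  choose N δ hδ hB using hB
  obtain ⟨o₀, ho₀⟩ := Finite.exists_min δ
  have hsome : ∀ N o (q : (B o).State) e ψ, (Automaton.stepThen s B).haltWeight N (some ⟨o, q⟩) e ψ =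
      (B o).haltWeight N q e ψ := fun N o =>
    haltWeight_map (A := Automaton.stepThen s B) (B := B o) (fun q => some ⟨o, q⟩) (fun q => rfl) N
  have key : ∀ o (q : (B o).State) e ψ,
      δ o₀ * weight ψ ≤ (Automaton.stepThen s B).haltWeight (∑ o, N o) (some ⟨o, q⟩) e ψ := by
    intro o q e ψ
    rw [hsome]
    calc δ o₀ * weight ψ ≤ δ o * weight ψ :=
          mul_le_mul_of_nonneg_right (ho₀ o) (weight_nonneg ψ)
      _ ≤ (B o).haltWeight (N o) q e ψ := hB o q e ψ
      _ ≤ _ := (B o).haltWeight_mono _ e ψ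
        (Finset.single_le_sum (fun _ _ => Nat.zero_le _) (Finset.mem_univ o))
  refine ⟨(∑ o, N o) + 1, δ o₀, hδ o₀, ?_⟩
  rintro (_ | ⟨o, q⟩) e ψ
  · have h := (Automaton.stepThen s B).haltWeight_succ_of_step (s := s) (q := none)
      (next := fun o => some ⟨o, (B o).start⟩) rfl (∑ o, N o) e ψ
    refine le_of_le_of_eq ?_ h.symm
    rw [← s.sum_weight_kraus e ψ, Finset.mul_sum]
    exact Finset.sum_le_sum fun o _ => key _ _ _ _
  · exact (key o q e ψ).trans ((Automaton.stepThen s B).haltWeight_mono _ e ψ (Nat.le_succ _))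

theorem Realizes.stepThen {s : Step n} {B : (Fin s.arity → Bool) → Automaton n}
    {U : Op (Fin n)} {L V : (Fin s.arity → Bool) → Op (Fin n)}
    {inv : ∀ o, (B o).State → Op (Fin n)} (hs : ∀ o, s.Implements o (L o))
    (hB : ∀ o, (B o).Realizes (V o) (inv o))
    (hU : ∀ o, ∃ c : ℂ, c ≠ 0 ∧ V o * L o = c • U) :
    (stepThen s B).Realizes U
      (fun q => q.elim 1 fun q => inv q.1 q.2 * L q.1) where
  start := rfl
  step := by
    rintro (_ | ⟨o, q⟩) s' next h o'
    · simp only [Automaton.stepThen, Option.some.injEq] at h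
      cases h
      exact ⟨L o', hs o', by simp [(hB o').start]⟩
    · obtain ⟨next', h', rfl⟩ := map_mapAction_eq_some h
      obtain ⟨M, hM, hinv⟩ := (hB o).step _ _ _ h' o'
      exact ⟨M, hM, by simp only [Option.elim_some]; rw [hinv, mul_assoc]⟩
  halt := by
    rintro (_ | ⟨o, q⟩) h
    · simp [Automaton.stepThen] at h
    · have h' : (B o).action q = none := Option.map_eq_none_iff.1 h
      obtain ⟨c, hc, hc'⟩ := (hB o).halt q h'
      obtain ⟨d, hd, hd'⟩ := hU o
      exact ⟨c * d, mul_ne_zero hc hd, by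
        simp only [Option.elim_some]; rw [hc', smul_mul_assoc, hd', smul_smul]⟩

end Automaton

/-! ### Programmable operators -/

section Programmable

variable {n : ℕ}

/-- Some automaton measuring only observables of `O` provably applies `U`. -/
def Programmable (O : Family) (U : Op (Fin n)) : Prop :=
  ∃ A : Automaton n, A.UsesOnly O ∧ (∃ inv, A.Realizes U inv) ∧ A.HaltsUniformly

theorem Programmable.simulable {O : Family} {U : Op (Fin n)} (h : Programmable O U) :
    Simulable O U := by
  obtain ⟨A, hO, ⟨inv, hinv⟩, hA⟩ := h
  exact ⟨A, hO, hinv.simulates hA⟩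

theorem Programmable.mul {O : Family} {U V : Op (Fin n)} (hV : Programmable O V)
    (hU : Programmable O U) : Programmable O (V * U) := by
  obtain ⟨A, hA, ⟨invA, hinvA⟩, hA'⟩ := hU
  obtain ⟨B, hB, ⟨invB, hinvB⟩, hB'⟩ := hV
  exact ⟨A.seq B, hA.seq hB, ⟨_, hinvA.seq hinvB⟩, hA'.seq hB'⟩

theorem Programmable.one (O : Family) : Programmable O (1 : Op (Fin n)) := by
  refine ⟨⟨Unit, inferInstance, (), fun _ => none⟩, ?_, ⟨fun _ => 1, rfl, ?_, ?_⟩, ?_⟩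
  · intro q s next h
    simp at h
  · intro q s next h
    simp at h
  · intro q _
    exact ⟨1, one_ne_zero, by simp⟩
  · refine ⟨0, 1, one_pos, fun q e ψ => ?_⟩
    rw [Automaton.haltWeight_of_halting _ rfl, one_mul]

theorem Programmable.smul {O : Family} {U : Op (Fin n)} (h : Programmable O U) {c : ℂ}
    (hc : c ≠ 0) : Programmable O (c • U) := by
  obtain ⟨A, hO, ⟨inv, hinv⟩, hA⟩ := h
  refine ⟨A, hO, ⟨inv, hinv.start, hinv.step, fun q hq => ?_⟩, hA⟩
  obtain ⟨d, hd, hd'⟩ := hinv.halt q hq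
  exact ⟨d * c⁻¹, mul_ne_zero hd (inv_ne_zero hc), by
    rw [hd', smul_smul, mul_assoc, inv_mul_cancel₀ hc, mul_one]⟩

theorem Programmable.stepThen {O : Family} {U : Op (Fin n)} {s : Step n}
    {L V : (Fin s.arity → Bool) → Op (Fin n)}
    (hs : ∀ (e : Placement n) (k : Fin s.arity), (s.obs e k).MemFamily O)
    (hL : ∀ o, s.Implements o (L o)) (hV : ∀ o, Programmable O (V o))
    (hU : ∀ o, ∃ c : ℂ, c ≠ 0 ∧ V o * L o = c • U) : Programmable O U := by
  choose B hB hinv hB' using hV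
  choose inv hinv using hinv
  exact ⟨Automaton.stepThen s B, Automaton.UsesOnly.stepThen hs hB,
    ⟨_, Automaton.Realizes.stepThen hL hinv hU⟩, Automaton.HaltsUniformly.stepThen hB'⟩

theorem LocalOp.MemFamily.mono {W : Type} {O O' : Family} (h1 : O.one ⊆ O'.one)
    (h2 : O.two ⊆ O'.two) {M : LocalOp W} (h : M.MemFamily O) : M.MemFamily O' := by
  cases M with
  | one a M => exact h1 h
  | two a b hab M => exact h.imp (@h2 _) (@h2 _)

theorem Programmable.mono {O O' : Family} (h1 : O.one ⊆ O'.one) (h2 : O.two ⊆ O'.two)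
    {U : Op (Fin n)} (h : Programmable O U) : Programmable O' U := by
  obtain ⟨A, hO, hA⟩ := h
  exact ⟨A, fun q s next hq e k => (hO q s next hq e k).mono h1 h2, hA⟩

end Programmable

/-! ### The gates `H` and `T` -/

theorem invSqrtTwo_mul_self : ((Real.sqrt 2 : ℝ) : ℂ)⁻¹ * ((Real.sqrt 2 : ℝ) : ℂ)⁻¹ = 2⁻¹ := by
  rw [← mul_inv, ← Complex.ofReal_mul, Real.mul_self_sqrt (by norm_num)]
  norm_num

/-- The eighth root of unity `e^{iπ/4}`. -/
def zeta8 : ℂ := Complex.exp (Complex.I * Real.pi / 4)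

theorem zeta8_eq : zeta8 = ((Real.sqrt 2 : ℝ) : ℂ)⁻¹ * (1 + Complex.I) := by
  have h : Complex.I * Real.pi / 4 = ((Real.pi / 4 : ℝ) : ℂ) * Complex.I := by
    push_cast; ring
  rw [zeta8, h, Complex.exp_mul_I, ← Complex.ofReal_cos, ← Complex.ofReal_sin, Real.cos_pi_div_four,
    Real.sin_pi_div_four]
  have h2 : ((Real.sqrt 2 / 2 : ℝ) : ℂ) = ((Real.sqrt 2 : ℝ) : ℂ)⁻¹ := by
    rw [Real.sqrt_div_self']; push_cast; ring
  rw [h2]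
  ring

theorem star_zeta8 : star zeta8 = ((Real.sqrt 2 : ℝ) : ℂ)⁻¹ * (1 - Complex.I) := by
  rw [zeta8_eq]
  simp [Complex.conj_ofReal]
  ring

theorem zeta8_mul_star : zeta8 * star zeta8 = 1 := by
  rw [star_zeta8, zeta8_eq]
  linear_combination (1 - Complex.I ^ 2) * invSqrtTwo_mul_self - 2⁻¹ * Complex.I_sq

theorem zeta8_sq : zeta8 ^ 2 = Complex.I := by
  rw [zeta8_eq]
  linear_combination (1 + Complex.I) ^ 2 * invSqrtTwo_mul_self + 2⁻¹ * Complex.I_sq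

theorem gateT_eq : gateT = !![1, 0; 0, zeta8] := rfl

theorem gateH_conjTranspose : gateHᴴ = gateH := by
  ext i j; fin_cases i <;> fin_cases j <;> simp [gateH, Complex.conj_ofReal]

theorem gateH_mul_self : gateH * gateH = 1 := by
  have h := invSqrtTwo_mul_self
  ext i j
  fin_cases i <;> fin_cases j <;>
    simp only [gateH, Matrix.mul_apply, Fin.sum_univ_two, Matrix.smul_apply, smul_eq_mul] <;>
    simp <;> linear_combination 2 * h

theorem gateH_mem_unitary : gateH ∈ Matrix.unitaryGroup (Fin 2) ℂ := by
  rw [Matrix.mem_unitaryGroup_iff, Matrix.star_eq_conjTranspose, gateH_conjTranspose,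
    gateH_mul_self]

theorem gateT_mem_unitary : gateT ∈ Matrix.unitaryGroup (Fin 2) ℂ := by
  rw [Matrix.mem_unitaryGroup_iff, Matrix.star_eq_conjTranspose, gateT_eq]
  have h := zeta8_mul_star
  ext i j
  fin_cases i <;> fin_cases j <;> simp [Matrix.mul_apply, Fin.sum_univ_two]
  exact h

theorem gateH_mul_pauliX_mul_gateH : gateH * pauliX * gateH = pauliZ := by
  have h := invSqrtTwo_mul_self
  ext i j
  fin_cases i <;> fin_cases j <;>
    simp [gateH, pauliX, pauliZ, Matrix.mul_apply, Fin.sum_univ_two] <;>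
    first | linear_combination 2 * h | linear_combination -2 * h

theorem gateH_mul_pauliZ_mul_gateH : gateH * pauliZ * gateH = pauliX := by
  rw [← gateH_mul_pauliX_mul_gateH]
  simp only [Matrix.mul_assoc]
  rw [gateH_mul_self, mul_one, ← Matrix.mul_assoc, gateH_mul_self, one_mul]

theorem gateT_mul_pauliX_mul : gateT * pauliX * gateTᴴ = diagXY := by
  have h1 := star_zeta8
  have h2 := zeta8_eq
  ext i j
  fin_cases i <;> fin_cases j <;>
    simp [gateT_eq, pauliX, pauliY, diagXY, Matrix.mul_apply, Fin.sum_univ_two]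
  · exact h1.trans (by ring)
  · exact h2

theorem gateT_mul_pauliZ_mul : gateT * pauliZ * gateTᴴ = pauliZ := by
  have h1 := zeta8_mul_star
  ext i j
  fin_cases i <;> fin_cases j <;>
    simp [gateT_eq, pauliZ, Matrix.mul_apply, Fin.sum_univ_two]
  exact h1

/-- The family contains `(X + Y)/√2` but not `(X - Y)/√2`, so a transfer gives `T†` more directly
than `T`. As `T†` has order 8, `T` is its seventh power. -/
theorem gateT_eq_conjTranspose_pow : gateT = gateTᴴ ^ 7 := by
  have h : gateTᴴ = Matrix.diagonal ![1, star zeta8] := by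
    ext i j; fin_cases i <;> fin_cases j <;> simp [gateT_eq]
  have h8 : star zeta8 ^ 8 = 1 := by
    rw [← star_pow, show (8 : ℕ) = 2 * 4 from rfl, pow_mul, zeta8_sq, Complex.I_pow_four, star_one]
  have h7 : star zeta8 ^ 7 = zeta8 := by
    calc star zeta8 ^ 7 = (zeta8 * star zeta8) * star zeta8 ^ 7 := by rw [zeta8_mul_star, one_mul]
      _ = zeta8 * star zeta8 ^ 8 := by ring
      _ = zeta8 := by rw [h8, mul_one]
  rw [h, Matrix.diagonal_pow]
  ext i j; fin_cases i <;> fin_cases j <;> simp [gateT_eq]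
  exact h7.symm

/-! ### Pauli operators up to a scalar -/

/-- The product of two Pauli operators, up to a scalar. -/
def pauliMul (p q : Bool × Bool) : Bool × Bool := (xor p.1 q.1, xor p.2 q.2)

theorem pauli_mul_pauli (p q : Bool × Bool) :
    ∃ c : ℂ, c ≠ 0 ∧ pauli p * pauli q = c • pauli (pauliMul p q) := by
  refine ⟨if p.2 && q.1 then -1 else 1, by split_ifs <;> norm_num, ?_⟩
  have hX := pauliX_mul_self
  have hZ := pauliZ_mul_self
  have hc : pauliZ * pauliX = -(pauliX * pauliZ) := by rw [pauliX_mul_pauliZ, neg_neg]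
  have e1 : ∀ M, pauliX * (pauliX * M) = M := fun M => by rw [← mul_assoc, hX, one_mul]
  have e2 : ∀ M, pauliZ * (pauliX * M) = -(pauliX * (pauliZ * M)) := fun M => by
    rw [← mul_assoc, hc, neg_mul, mul_assoc]
  obtain ⟨p1, p2⟩ := p
  obtain ⟨q1, q2⟩ := q
  cases p1 <;> cases p2 <;> cases q1 <;> cases q2 <;>
    simp [pauli, pauliMul, mul_assoc, hX, hZ, hc, e1, e2]

theorem pauli_mul_self (p : Bool × Bool) : ∃ c : ℂ, c ≠ 0 ∧ pauli p * pauli p = c • 1 := by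
  obtain ⟨c, hc, h⟩ := pauli_mul_pauli p p
  exact ⟨c, hc, by rw [h]; simp [pauliMul, pauli]⟩

/-- `H` exchanges `X` and `Z`, hence the two exponents. The sign comes from reordering when both
factors are present. -/
theorem gateH_mul_pauli_mul_gateH (p : Bool × Bool) :
    ∃ c : ℂ, c ≠ 0 ∧ gateH * pauli p * gateH = c • pauli p.swap := by
  have hX := gateH_mul_pauliX_mul_gateH
  have hZ := gateH_mul_pauliZ_mul_gateH
  refine ⟨if p.1 && p.2 then -1 else 1, by split_ifs <;> norm_num, ?_⟩
  obtain ⟨p1, p2⟩ := p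
  have hXZ : gateH * (pauliX * pauliZ) * gateH = pauliZ * pauliX := by
    calc gateH * (pauliX * pauliZ) * gateH
        = gateH * pauliX * (gateH * gateH) * pauliZ * gateH := by
          rw [gateH_mul_self, mul_one]; simp only [mul_assoc]
      _ = (gateH * pauliX * gateH) * (gateH * pauliZ * gateH) := by simp only [mul_assoc]
      _ = pauliZ * pauliX := by rw [hX, hZ]
  cases p1 <;> cases p2 <;> simp [pauli, hX, hZ, gateH_mul_self, hXZ]
  rw [pauliX_mul_pauliZ, neg_neg]

/-! ### Gates programmed with the observables `Z, X, (X+Y)/√2, Z ⊗ X` -/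

section Gates

variable {n : ℕ}

/-- `H` as an element of the unitary group. -/
def unitaryH : Matrix.unitaryGroup (Fin 2) ℂ := ⟨gateH, gateH_mem_unitary⟩

/-- `T` as an element of the unitary group. -/
def unitaryT : Matrix.unitaryGroup (Fin 2) ℂ := ⟨gateT, gateT_mem_unitary⟩

/-! ### Steps whose observables lie in the second family -/

theorem transfer_obs_memFamily {O : Family} {i : Fin n} {U V : Matrix.unitaryGroup (Fin 2) ℂ}
    (h0 : V.1 * pauliX * V.1ᴴ ∈ O.one)
    (h1 : (U.1ᴴ * pauliZ * U.1) ⊗ₖ (V.1 * pauliZ * V.1ᴴ) ∈ O.two ∨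
      (V.1 * pauliZ * V.1ᴴ) ⊗ₖ (U.1ᴴ * pauliZ * U.1) ∈ O.two)
    (h2 : U.1ᴴ * pauliX * U.1 ∈ O.one) (e : Placement n)
    (k : Fin (Step.transfer i U V).arity) : ((Step.transfer i U V).obs e k).MemFamily O := by
  change Fin 3 at k
  fin_cases k
  · exact h0
  · refine h1.imp id fun h => ?_
    convert h using 1
    ext ⟨a, b⟩ ⟨c, d⟩
    simp only [Matrix.submatrix_apply, Prod.swap_prod_mk, Matrix.kroneckerMap_apply]
    ring
  · exact h2

theorem cnot_obs_memFamily {i j : Fin n} (hij : i ≠ j) (e : Placement n)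
    (k : Fin (Step.cnot i j hij).arity) :
    ((Step.cnot i j hij).obs e k).MemFamily obsFamily₂ := by
  change Fin 4 at k
  fin_cases k
  · exact Or.inl rfl
  · exact Or.inl rfl
  · exact Or.inl rfl
  · exact Or.inr (Or.inl rfl)

theorem transfer_H_one_memFamily (i : Fin n) (e : Placement n)
    (k : Fin (Step.transfer i unitaryH 1).arity) :
    ((Step.transfer i unitaryH 1).obs e k).MemFamily obsFamily₂ := by
  apply transfer_obs_memFamily <;>
    simp [unitaryH, gateH_conjTranspose, gateH_mul_pauliX_mul_gateH, gateH_mul_pauliZ_mul_gateH,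
      obsFamily₂]

theorem transfer_one_H_memFamily (i : Fin n) (e : Placement n)
    (k : Fin (Step.transfer i 1 unitaryH).arity) :
    ((Step.transfer i 1 unitaryH).obs e k).MemFamily obsFamily₂ := by
  apply transfer_obs_memFamily <;>
    simp [unitaryH, gateH_conjTranspose, gateH_mul_pauliX_mul_gateH, gateH_mul_pauliZ_mul_gateH,
      obsFamily₂]

/-- With `U = T†`, conjugation turns `X` into `(X + Y)/√2` and leaves `Z` alone. Taking `V = H`
makes the two-qubit observable `Z ⊗ X` instead of `Z ⊗ Z`. -/
theorem transfer_T_H_memFamily (i : Fin n) (e : Placement n)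
    (k : Fin (Step.transfer i unitaryT⁻¹ unitaryH).arity) :
    ((Step.transfer i unitaryT⁻¹ unitaryH).obs e k).MemFamily obsFamily₂ := by
  have hT : (unitaryT⁻¹).1 = gateTᴴ := rfl
  apply transfer_obs_memFamily <;>
    simp [hT, unitaryH, gateH_conjTranspose, gateH_mul_pauliX_mul_gateH,
      gateH_mul_pauliZ_mul_gateH, gateT_mul_pauliX_mul, gateT_mul_pauliZ_mul, obsFamily₂]

/-- The automaton that applies the Pauli operator `p` to the `i`-th qubit: it transfers the qubit
twice, with `H` before the first transfer and after the second one, until the errors amount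
to `p`. -/
def pauliLoop (i : Fin n) (p : Bool × Bool) : Automaton n where
  State := Bool × (Bool × Bool)
  finite := inferInstance
  start := (false, p)
  action
    -- The component `q` is the Pauli operator, up to a scalar, by which the work done differs from
    -- the target `p`; initially nothing is done and `q = p`. Moving `H` past it swaps its two
    -- exponents. The Boolean records whether an `H` is still to be cancelled.
    | (false, q) => if q = (false, false) then none else
        some ⟨.transfer i unitaryH 1, fun o => (true, pauliMul (transferError o) q.swap)⟩
    | (true, q) =>
        some ⟨.transfer i 1 unitaryH, fun o => (false, (pauliMul (transferError o) q).swap)⟩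

theorem pauliLoop_action_false (i : Fin n) (p : Bool × Bool) {q : Bool × Bool}
    (hq : q ≠ (false, false)) : (pauliLoop i p).action (false, q) =
      some ⟨.transfer i unitaryH 1, fun o => (true, pauliMul (transferError o) q.swap)⟩ :=
  if_neg hq

theorem pauliLoop_usesOnly (i : Fin n) (p : Bool × Bool) :
    (pauliLoop i p).UsesOnly obsFamily₂ := by
  rintro ⟨_ | _, q⟩ s next h
  · by_cases hq : q = (false, false)
    · simp [pauliLoop, hq] at h
    · rw [pauliLoop_action_false i p hq] at h
      cases h
      exact transfer_H_one_memFamily i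
  · cases h
    exact transfer_one_H_memFamily i

/-- The second transfer of a round produces the error `q` with probability 1/4, and then nothing
remains to be corrected. From any state this opportunity comes within two steps. -/
theorem pauliLoop_haltsUniformly (i : Fin n) (p : Bool × Bool) :
    (pauliLoop i p).HaltsUniformly := by
  have htrue : ∀ q e ψ, 4⁻¹ * weight ψ ≤ (pauliLoop i p).haltWeight 1 (true, q) e ψ := by
    intro q e ψ
    have h := (pauliLoop i p).haltWeight_succ_of_step (q := (true, q))
      (s := .transfer i 1 unitaryH) rfl 0 e ψ
    refine le_of_le_of_eq ?_ h.symm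
    have hsum := sum_weight_kraus_transfer e i 1 unitaryH q ψ
    rw [inv_mul_eq_div, ← hsum]
    refine le_trans (Finset.sum_le_sum fun o ho => ?_)
      (Finset.sum_le_sum_of_subset_of_nonneg (Finset.filter_subset _ _)
        fun o _ _ => Automaton.haltWeight_nonneg _ _ _ _ _)
    refine (Automaton.haltWeight_of_halting _ ?_ _ _ _).ge
    have : pauliMul q q = (false, false) := by simp [pauliMul]
    simp only [Finset.mem_filter] at ho
    simp [pauliLoop, ho.2, this]
  refine ⟨2, 4⁻¹, by norm_num, ?_⟩
  rintro ⟨_ | _, q⟩ e ψ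
  · by_cases hq : q = (false, false)
    · refine le_trans ?_ (Automaton.haltWeight_of_halting _ ?_ _ _ _).ge
      · linarith [weight_nonneg ψ]
      · simp [pauliLoop, hq]
    · rw [Automaton.haltWeight_succ_of_step _ (pauliLoop_action_false i p hq),
        ← Step.sum_weight_kraus e _ ψ, Finset.mul_sum]
      exact Finset.sum_le_sum fun o _ => htrue _ _ _
  · exact (htrue q e ψ).trans ((pauliLoop i p).haltWeight_mono _ e ψ one_le_two)

theorem programmable_pauli (i : Fin n) (p : Bool × Bool) :
    Programmable obsFamily₂ (onQubit i (pauli p)) := by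
  obtain ⟨c₀, hc₀, h₀⟩ := pauli_mul_self p
  -- The invariant is `q p` or `q H p`. At the start it is `p p`, a scalar `c₀`, which the factor
  -- `c₀⁻¹` normalises to 1.
  refine ⟨pauliLoop i p, pauliLoop_usesOnly i p, ⟨fun q => c₀⁻¹ • onQubit i
    (pauli q.2 * (if q.1 then gateH else 1) * pauli p), ?_, ?_, ?_⟩, pauliLoop_haltsUniformly i p⟩
  · simp [pauliLoop, h₀, hc₀]
  · rintro ⟨_ | _, q⟩ s next h o
    · by_cases hq : q = (false, false)
      · simp [pauliLoop, hq] at h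
      · rw [pauliLoop_action_false i p hq] at h
        cases h
        obtain ⟨c, hc, h1⟩ := pauli_mul_pauli (transferError o) q.swap
        obtain ⟨d, hd, h2⟩ := gateH_mul_pauli_mul_gateH q
        refine ⟨_, (Step.implements_transfer i unitaryH 1 o).smul
          (inv_ne_zero (mul_ne_zero hc hd)), ?_⟩
        simp only [unitaryH, if_true, Bool.false_eq_true, if_false, mul_one, OneMemClass.coe_one,
          one_mul]
        rw [smul_mul_smul_comm, ← map_mul, ← map_smul, ← map_smul]
        congr 1
        have h3 : gateH * pauli q = d • pauli q.swap * gateH := by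
          rw [← h2, mul_assoc (gateH * pauli q), gateH_mul_self, mul_one]
        rw [mul_assoc (pauli (transferError o)), ← mul_assoc gateH, h3, ← mul_assoc, ← mul_assoc,
          mul_smul_comm, h1]
        simp only [smul_mul_assoc, smul_smul]
        congr 1
        field_simp
    · cases h
      obtain ⟨c, hc, h1⟩ := pauli_mul_pauli (transferError o) q
      obtain ⟨d, hd, h2⟩ := gateH_mul_pauli_mul_gateH (pauliMul (transferError o) q)
      refine ⟨_, (Step.implements_transfer i 1 unitaryH o).smul
        (inv_ne_zero (mul_ne_zero hc hd)), ?_⟩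
      simp only [unitaryH, if_true, Bool.false_eq_true, if_false, mul_one, OneMemClass.coe_one]
      rw [smul_mul_smul_comm, ← map_mul, ← map_smul, ← map_smul]
      congr 1
      have h3 : gateH * pauli (transferError o) * (pauli q * gateH * pauli p) =
          (c * d) • (pauli (pauliMul (transferError o) q).swap * pauli p) := by
        calc gateH * pauli (transferError o) * (pauli q * gateH * pauli p)
            = gateH * (pauli (transferError o) * pauli q) * gateH * pauli p := by
              simp only [mul_assoc]
          _ = _ := by
            rw [h1, mul_smul_comm, smul_mul_assoc, h2, smul_smul, smul_mul_assoc]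
      rw [h3, smul_smul]
      congr 1
      field_simp
  · rintro ⟨_ | _, q⟩ h
    · by_cases hq : q = (false, false)
      · exact ⟨c₀⁻¹, inv_ne_zero hc₀, by simp [hq, pauli]⟩
      · rw [pauliLoop_action_false i p hq] at h
        simp at h
    · simp [pauliLoop] at h

theorem programmable_pauli_conj (i : Fin n) (V : Matrix.unitaryGroup (Fin 2) ℂ)
    (p q : Bool × Bool) {c : ℂ} (hc : c ≠ 0) (h : V.1 * pauli p * V.1ᴴ = c • pauli q) :
    Programmable obsFamily₂ (onQubit i (V.1 * pauli p * V.1ᴴ)) := by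
  rw [h, map_smul]
  exact (programmable_pauli i q).smul hc

/-- If the errors of a state transfer can be corrected, then it applies `V U` to the data. -/
theorem programmable_transfer {O : Family} (i : Fin n) (U V : Matrix.unitaryGroup (Fin 2) ℂ)
    (hO : ∀ e k, ((Step.transfer i U V).obs e k).MemFamily O)
    (hV : ∀ p, Programmable O (onQubit i (V.1 * pauli p * V.1ᴴ))) :
    Programmable O (onQubit i (V.1 * U.1)) := by
  refine Programmable.stepThen hO (Step.implements_transfer i U V)
    (fun o => hV (transferError o)) fun o => ?_
  obtain ⟨c, hc, h⟩ := pauli_mul_self (transferError o)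
  refine ⟨c, hc, ?_⟩
  rw [← map_mul, ← map_smul]
  congr 1
  calc V.1 * pauli (transferError o) * V.1ᴴ * (V.1 * pauli (transferError o) * U.1)
      = V.1 * pauli (transferError o) * (V.1ᴴ * V.1) * pauli (transferError o) * U.1 := by
        simp only [mul_assoc]
    _ = V.1 * (pauli (transferError o) * pauli (transferError o)) * U.1 := by
        rw [unitary_conjTranspose_mul, mul_one, mul_assoc V.1]
    _ = c • (V.1 * U.1) := by rw [h, mul_smul_comm, mul_one, smul_mul_assoc]

theorem programmable_gateH (i : Fin n) : Programmable obsFamily₂ (onQubit i gateH) := by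
  have := programmable_transfer i unitaryH 1 (transfer_H_one_memFamily i) fun p => by
    simpa using programmable_pauli i p
  simpa [unitaryH] using this

/-- The transfer with `U = T†` and `V = H` applies `H T†`, and its errors are correctable because
`H` normalises the Pauli group. A further `H` isolates `T†`. -/
theorem programmable_gateT (i : Fin n) : Programmable obsFamily₂ (onQubit i gateT) := by
  have h1 : Programmable obsFamily₂ (onQubit i (gateH * gateTᴴ)) :=
    programmable_transfer i unitaryT⁻¹ unitaryH (transfer_T_H_memFamily i) fun p => by
      obtain ⟨c, hc, h⟩ := gateH_mul_pauli_mul_gateH p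
      refine programmable_pauli_conj i unitaryH p p.swap hc ?_
      change gateH * pauli p * gateHᴴ = _
      rw [gateH_conjTranspose, h]
  have h2 : Programmable obsFamily₂ (onQubit i gateTᴴ) := by
    have := (programmable_gateH i).mul h1
    rwa [← map_mul, ← mul_assoc, gateH_mul_self, one_mul] at this
  have h3 : ∀ k : ℕ, Programmable obsFamily₂ (onQubit i gateTᴴ ^ k) := by
    intro k
    induction k with
    | zero => simpa using Programmable.one _
    | succ k ih => rw [pow_succ]; exact ih.mul h2
  rw [gateT_eq_conjTranspose_pow, map_pow]
  exact h3 7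

theorem pauli_correction_cnotOp {i j : Fin n} (hij : i ≠ j) (p q : Bool × Bool) :
    ∃ c : ℂ, c ≠ 0 ∧ onQubit j (pauli q) * onQubit i (pauli p) *
      (onQubit i (pauli p) * onQubit j (pauli q) * cnotOp hij) = c • cnotOp hij := by
  obtain ⟨c, hc, h⟩ := pauli_mul_self p
  obtain ⟨d, hd, h'⟩ := pauli_mul_self q
  refine ⟨c * d, mul_ne_zero hc hd, ?_⟩
  calc onQubit j (pauli q) * onQubit i (pauli p) *
        (onQubit i (pauli p) * onQubit j (pauli q) * cnotOp hij)
      = onQubit j (pauli q) * (onQubit i (pauli p) * onQubit i (pauli p)) *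
          onQubit j (pauli q) * cnotOp hij := by
        simp only [mul_assoc]
    _ = c • (onQubit j (pauli q) * onQubit j (pauli q)) * cnotOp hij := by
        rw [← map_mul, h, map_smul, map_one, mul_smul_comm, mul_one, smul_mul_assoc]
    _ = _ := by
        rw [← map_mul, h', map_smul, map_one, smul_smul, smul_mul_assoc, one_mul]

theorem programmable_cnotOp {i j : Fin n} (hij : i ≠ j) :
    Programmable obsFamily₂ (cnotOp hij) :=
  Programmable.stepThen (cnot_obs_memFamily hij) (Step.implements_cnot hij)
    (fun o : Fin 4 → Bool => (programmable_pauli j (xor (o 1) (o 3), false)).mul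
      (programmable_pauli i (false, xor (o 0) (o 2))))
    fun _ => pauli_correction_cnotOp hij _ _

theorem obsFamily₂_one_subset : obsFamily₂.one ⊆ obsFamily₁.one := subset_rfl

theorem obsFamily₂_two_subset : obsFamily₂.two ⊆ obsFamily₁.two := by
  rintro M rfl
  exact Or.inr rfl

/-! ### Arbitrary one-qubit gates, and circuits -/

theorem programmable_onQubit_allObs (i : Fin n) (U : Matrix.unitaryGroup (Fin 2) ℂ) :
    Programmable allObs (onQubit i U.1) := by
  -- Putting the gate before the transfer (`V = 1`) leaves a bare Pauli error, so arbitrary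
  -- unitaries need no correction beyond Pauli operators.
  have := programmable_transfer (O := allObs) i U 1
    (transfer_obs_memFamily trivial (Or.inl trivial) trivial) fun p => by
      simpa using (programmable_pauli i p).mono (Set.subset_univ _) (Set.subset_univ _)
  simpa using this

theorem programmable_circuit {O G : Family} (c : Circuit n) (hc : c.Over G)
    (h1 : ∀ M ∈ G.one, ∀ i : Fin n, Programmable O (onQubit i M)) (h2 : G.two ⊆ {gateCNot})
    (h3 : ∀ (i j : Fin n) (hij : i ≠ j), Programmable O (cnotOp hij)) : Programmable O c.toOp := by
  induction c with
  | nil => exact Programmable.one O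
  | cons g c ih =>
    have hg : Programmable O g.toOp := by
      have hmem := hc g List.mem_cons_self
      cases g with
      | one a M => exact h1 M hmem a
      | two a b hab M =>
        rcases hmem with h | h
        · obtain rfl := h2 h
          exact h3 a b hab
        -- A gate that matches only after exchanging its qubits is a controlled-not with control and
        -- target exchanged.
        · rw [toOp_two_swap, h2 h]
          exact h3 b a hab.symm
    have := (ih fun g' hg' => hc g' (List.mem_cons_of_mem _ hg')).mul hg
    simpa [Circuit.toOp] using this

theorem programmable_gatesHT (c : Circuit n) (hc : c.Over gatesHT) :
    Programmable obsFamily₂ c.toOp := by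
  refine programmable_circuit c hc ?_ subset_rfl fun i j hij => programmable_cnotOp hij
  rintro M (rfl | rfl) i
  · exact programmable_gateH i
  · exact programmable_gateT i

theorem programmable_gatesHHT (c : Circuit n) (hc : c.Over gatesHHT) :
    Programmable obsFamily₂ c.toOp := by
  refine programmable_circuit c hc ?_ subset_rfl fun i j hij => programmable_cnotOp hij
  rintro M (rfl | rfl) i
  · exact programmable_gateH i
  · rw [map_mul]
    exact (programmable_gateH i).mul (programmable_gateT i)

end Gates

/-! ### Generation of the unitary group by diagonal matrices and a transitive set -/

section Reflections

variable {ι : Type} [Fintype ι] [DecidableEq ι]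

/-- The unitary matrices of `G` whose inverses are in `G`. -/
def unitaryPart (G : Submonoid (Matrix ι ι ℂ)) : Submonoid (Matrix ι ι ℂ) where
  carrier := {g | g ∈ G ∧ gᴴ ∈ G ∧ g ∈ Matrix.unitaryGroup ι ℂ}
  one_mem' := ⟨one_mem _, by simp, one_mem _⟩
  mul_mem' := fun ha hb => ⟨mul_mem ha.1 hb.1, by
    rw [Matrix.conjTranspose_mul]; exact mul_mem hb.2.1 ha.2.1, mul_mem ha.2.2 hb.2.2⟩

theorem conjTranspose_mem_unitaryPart {G : Submonoid (Matrix ι ι ℂ)} {g : Matrix ι ι ℂ}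
    (hg : g ∈ unitaryPart G) : gᴴ ∈ unitaryPart G :=
  ⟨hg.2.1, by simpa using hg.1, Unitary.star_mem hg.2.2⟩

theorem unitary_mulVec_norm {g : Matrix ι ι ℂ} (hg : g ∈ Matrix.unitaryGroup ι ℂ) (v : ι → ℂ) :
    star (g *ᵥ v) ⬝ᵥ (g *ᵥ v) = star v ⬝ᵥ v := by
  have h : gᴴ * g = 1 := Matrix.mem_unitaryGroup_iff'.1 hg
  rw [Matrix.star_mulVec, ← Matrix.dotProduct_mulVec, Matrix.mulVec_mulVec, h, Matrix.one_mulVec]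

theorem diagonal_eq_one_add_vecMulVec {ι : Type} [DecidableEq ι] (k : ι) (b c : ℂ) :
    Matrix.diagonal (fun j => if j = k then 1 + b * (star c * c) else 1) =
      1 + b • Matrix.vecMulVec (Pi.single k c) (star (Pi.single k c)) := by
  ext i j
  simp only [Matrix.diagonal_apply, Matrix.add_apply, Matrix.one_apply, Matrix.smul_apply,
    Matrix.vecMulVec_apply, Pi.star_apply, Pi.single_apply, smul_eq_mul]
  by_cases hi : i = k <;> by_cases hj : j = k <;> by_cases hij : i = j <;>
    simp_all [mul_comm]

/-- Carry `u` to a multiple of a basis vector by an element of `unitaryPart G`: the rank-one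
perturbation of the identity then becomes diagonal, with the single nontrivial entry `1 + b ⟨u, u⟩`.
-/
theorem reflection_mem (G : Submonoid (Matrix ι ι ℂ))
    (hdiag : ∀ d : ι → ℂ, (∀ k, ‖d k‖ = 1) → Matrix.diagonal d ∈ G)
    (htrans : ∀ v : ι → ℂ, ∃ g ∈ unitaryPart G, ∃ k c, g *ᵥ v = Pi.single k c)
    (u : ι → ℂ) (b : ℂ) (hb : ‖1 + b * (star u ⬝ᵥ u)‖ = 1) :
    1 + b • Matrix.vecMulVec u (star u) ∈ G := by
  obtain ⟨g, hg, k, c, hgu⟩ := htrans u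
  have h1 : gᴴ * g = 1 := Matrix.mem_unitaryGroup_iff'.1 hg.2.2
  have h2 : star (g *ᵥ u) ⬝ᵥ (g *ᵥ u) = star u ⬝ᵥ u := unitary_mulVec_norm hg.2.2 u
  have hc : star c * c = star u ⬝ᵥ u := by
    rw [← h2, hgu, dotProduct_single, Pi.star_apply, Pi.single_eq_same]
  have hu : u = gᴴ *ᵥ Pi.single k c := by
    rw [← hgu, Matrix.mulVec_mulVec, h1, Matrix.one_mulVec]
  have key : 1 + b • Matrix.vecMulVec u (star u) =
      gᴴ * Matrix.diagonal (fun j => if j = k then 1 + b * (star u ⬝ᵥ u) else 1) * g := by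
    have h3 : Matrix.diagonal (fun j => if j = k then 1 + b * (star u ⬝ᵥ u) else 1) =
        1 + b • Matrix.vecMulVec (Pi.single k c) (star (Pi.single k c)) := by
      rw [← hc, diagonal_eq_one_add_vecMulVec]
    rw [h3, mul_add, add_mul, mul_one, h1, mul_smul_comm, smul_mul_assoc, Matrix.mul_vecMulVec,
      Matrix.vecMulVec_mul, ← hu]
    congr 3
    rw [hu, Matrix.star_mulVec, Matrix.conjTranspose_conjTranspose]
  rw [key]
  refine mul_mem (mul_mem hg.2.1 (hdiag _ fun j => ?_)) hg.1
  split_ifs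
  · exact hb
  · simp

open scoped ComplexOrder in
/-- A monoid of matrices that contains the diagonal unitary matrices, and that maps every vector to
a multiple of a basis vector, contains all unitary matrices. -/
theorem unitary_mem_of_transitive (G : Submonoid (Matrix ι ι ℂ))
    (hdiag : ∀ d : ι → ℂ, (∀ k, ‖d k‖ = 1) → Matrix.diagonal d ∈ G)
    (htrans : ∀ v : ι → ℂ, ∃ g ∈ unitaryPart G, ∃ k c, g *ᵥ v = Pi.single k c)
    (U : Matrix ι ι ℂ) (hU : U ∈ Matrix.unitaryGroup ι ℂ) : U ∈ G := by
  -- Induction on a set outside which all basis vectors are fixed; each stage fixes one more by a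
  -- complex reflection.
  have key : ∀ (s : Finset ι) (U : Matrix ι ι ℂ), U ∈ Matrix.unitaryGroup ι ℂ →
      (∀ i ∉ s, U *ᵥ Pi.single i 1 = Pi.single i 1) → U ∈ G := by
    intro s
    induction s using Finset.induction_on with
    | empty =>
      intro U _ hfix
      have : U = 1 := by
        apply Matrix.ext_of_mulVec_single
        intro i
        rw [hfix i (Finset.notMem_empty i), Matrix.one_mulVec]
      rw [this]
      exact one_mem G
    | insert k s hk ih =>
      intro U hU hfix
      by_cases hw : U *ᵥ Pi.single k 1 = Pi.single k 1
      · refine ih U hU fun i hi => ?_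
        by_cases hik : i = k
        · rw [hik, hw]
        · exact hfix i (by simp [hik, hi])
      set w := U *ᵥ Pi.single k 1 with hwdef
      have hww : star w ⬝ᵥ w = 1 := by
        rw [hwdef, unitary_mulVec_norm hU]; simp
      -- With `a = ⟨u, w⟩`, the map `R = 1 - a⁻¹ u u†` sends `w` to `w - u`, the basis vector at
      -- `k`. It is unitary because `⟨u, u⟩ = a + star a`, and `a ≠ 0` because `u ≠ 0`.
      set u := w - Pi.single k 1 with hu
      set a : ℂ := 1 - w k with ha
      have huw : star u ⬝ᵥ w = a := by
        rw [hu, star_sub, sub_dotProduct, hww, ha, ← Pi.single_star, star_one,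
          single_one_dotProduct]
      have huk : star u ⬝ᵥ Pi.single k 1 = -star a := by
        rw [dotProduct_single_one, Pi.star_apply, hu, ha, Pi.sub_apply, Pi.single_eq_same,
          ← star_neg, neg_sub]
      have huu : star u ⬝ᵥ u = a + star a := by
        conv_lhs => rw [hu, dotProduct_sub]
        rw [← hu, huw, huk, sub_neg_eq_add]
      have ha0 : a ≠ 0 := by
        intro h0
        rw [h0, star_zero, add_zero] at huu
        exact hw (sub_eq_zero.1 (dotProduct_star_self_eq_zero.1 huu))
      have ha0' : star a ≠ 0 := star_ne_zero.2 ha0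
      have hmemR : 1 + (-a⁻¹) • Matrix.vecMulVec u (star u) ∈ G := by
        apply reflection_mem G hdiag htrans
        rw [huu, show 1 + -a⁻¹ * (a + star a) = -(star a / a) by field_simp; ring, norm_neg,
          norm_div, norm_star, div_self (norm_ne_zero_iff.2 ha0)]
      have hmemR' : 1 + (-(star a)⁻¹) • Matrix.vecMulVec u (star u) ∈ G := by
        apply reflection_mem G hdiag htrans
        rw [huu, show 1 + -(star a)⁻¹ * (a + star a) = -(a / star a) by field_simp; ring, norm_neg,
          norm_div, norm_star, div_self (norm_ne_zero_iff.2 ha0)]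
      set R := 1 + (-a⁻¹) • Matrix.vecMulVec u (star u) with hR
      set R' := 1 + (-(star a)⁻¹) • Matrix.vecMulVec u (star u) with hR'
      have hvv : Matrix.vecMulVec u (star u) * Matrix.vecMulVec u (star u) =
          (a + star a) • Matrix.vecMulVec u (star u) := by
        rw [Matrix.vecMulVec_mul_vecMulVec, huu]
        ext i j; simp [Matrix.vecMulVec_apply]; ring
      have hR'R : R' * R = 1 := by
        rw [hR, hR', mul_add, mul_one, add_mul, one_mul, smul_mul_smul_comm, hvv, smul_smul]
        have : -(star a)⁻¹ + (-a⁻¹ + -(star a)⁻¹ * -a⁻¹ * (a + star a)) = 0 := by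
          field_simp; ring
        rw [add_assoc, ← add_smul, ← add_smul, this, zero_smul, add_zero]
      have hstar : Rᴴ = R' := by
        rw [hR, hR', Matrix.conjTranspose_add, Matrix.conjTranspose_one,
          Matrix.conjTranspose_smul, Matrix.conjTranspose_vecMulVec, star_star, star_neg,
          star_inv₀]
      have hRU : R ∈ Matrix.unitaryGroup ι ℂ := by
        rw [Matrix.mem_unitaryGroup_iff', Matrix.star_eq_conjTranspose, hstar, hR'R]
      have hRv : ∀ v, R *ᵥ v = v - (a⁻¹ * (star u ⬝ᵥ v)) • u := by
        intro v
        rw [hR, Matrix.add_mulVec, Matrix.one_mulVec, Matrix.smul_mulVec,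
          Matrix.vecMulVec_mulVec]
        ext i
        simp
        ring
      have hfixed : R * U ∈ G := by
        refine ih (R * U) (mul_mem hRU hU) fun i hi => ?_
        rw [← Matrix.mulVec_mulVec]
        by_cases hik : i = k
        · rw [hik, ← hwdef, hRv, huw, inv_mul_cancel₀ ha0, one_smul, hu, sub_sub_cancel]
        · rw [hfix i (by simp [hik, hi]), hRv]
          -- A basis vector already fixed by `U` is orthogonal to `w`, hence to `u`, so the
          -- reflection does not disturb it.
          have : star u ⬝ᵥ Pi.single i 1 = 0 := by
            have horth : star w ⬝ᵥ Pi.single i 1 = 0 := by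
              have hUU : Uᴴ * U = 1 := Matrix.mem_unitaryGroup_iff'.1 hU
              rw [hwdef, Matrix.star_mulVec, ← hfix i (by simp [hik, hi]),
                ← Matrix.dotProduct_mulVec, Matrix.mulVec_mulVec, hUU, Matrix.one_mulVec]
              simp [hik]
            rw [hu, star_sub, sub_dotProduct, horth]
            simp [hik]
          rw [this, mul_zero, zero_smul, sub_zero]
      have : U = R' * (R * U) := by rw [← mul_assoc, hR'R, one_mul]
      rw [this]
      exact mul_mem hmemR' hfixed
  exact key Finset.univ U hU fun i hi => absurd (Finset.mem_univ i) hi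

end Reflections

/-! ### Diagonal unitary operators -/

section Diagonal

variable {n : ℕ}

theorem diagonal_mem_unitary {ι : Type} [Fintype ι] [DecidableEq ι] {d : ι → ℂ}
    (hd : ∀ x, ‖d x‖ = 1) : Matrix.diagonal d ∈ Matrix.unitaryGroup ι ℂ := by
  rw [Matrix.mem_unitaryGroup_iff, Matrix.star_eq_conjTranspose, Matrix.diagonal_conjTranspose,
    Matrix.diagonal_mul_diagonal, ← Matrix.diagonal_one]
  congr 1
  funext s
  rw [Pi.star_apply, Complex.star_def, Complex.mul_conj, Complex.normSq_eq_norm_sq, hd]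
  simp

theorem onQubit_diagonal {W : Type} [Fintype W] [DecidableEq W] (a : W) (u : Fin 2 → ℂ) :
    onQubit a (Matrix.diagonal u) = Matrix.diagonal fun x => u (x a) := by
  apply Op.ext_mulVec
  intro ψ x
  rw [onQubit_mulVec, Matrix.mulVec_diagonal, Finset.sum_eq_single (x a)]
  · simp
  · intro t _ ht
    rw [Matrix.diagonal_apply_ne _ ht.symm, zero_mul]
  · simp

theorem cnotOp_mul_diagonal_mul {W : Type} [Fintype W] [DecidableEq W] {a b : W} (hab : a ≠ b)
    (g : (W → Fin 2) → ℂ) :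
    cnotOp hab * Matrix.diagonal g * cnotOp hab =
      Matrix.diagonal fun x => g (Function.update x b (x a + x b)) := by
  apply Op.ext_mulVec
  intro ψ x
  rw [← Matrix.mulVec_mulVec, ← Matrix.mulVec_mulVec, cnotOp_mulVec, Matrix.mulVec_diagonal,
    cnotOp_mulVec, Matrix.mulVec_diagonal]
  have : ∀ s t : Fin 2, s + (s + t) = t := by decide
  simp [Function.update_of_ne hab, this]

/-- The sign `(-1)^t` of a bit. -/
def bitSign (t : Fin 2) : ℝ := if t = 0 then 1 else -1

theorem bitSign_add (s t : Fin 2) : bitSign (s + t) = bitSign s * bitSign t := by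
  fin_cases s <;> fin_cases t <;> simp [bitSign]

theorem bitSign_mul_self (t : Fin 2) : bitSign t * bitSign t = 1 := by
  rw [bitSign]; split_ifs <;> norm_num

/-- The functions all multiples of which are phases of diagonal operators of `G`. -/
def phaseSpace (G : Submonoid (Op (Fin n))) : Submodule ℝ ((Fin n → Fin 2) → ℝ) where
  carrier := {f | ∀ t : ℝ,
    Matrix.diagonal (fun x => Complex.exp (((t * f x : ℝ) : ℂ) * Complex.I)) ∈ G}
  zero_mem' := fun t => by
    simp
  add_mem' := by
    intro f g hf hg t
    have := mul_mem (hf t) (hg t)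
    rw [Matrix.diagonal_mul_diagonal] at this
    refine cast (congrArg (fun d => Matrix.diagonal d ∈ G) (funext fun x => ?_)) this
    rw [← Complex.exp_add]
    congr 1
    simp only [Pi.add_apply]
    push_cast
    ring
  smul_mem' := by
    intro c f hf t
    refine cast (congrArg (fun d => Matrix.diagonal d ∈ G) (funext fun x => ?_)) (hf (t * c))
    simp only [Pi.smul_apply, smul_eq_mul, mul_assoc]

theorem bitSign_mem_phaseSpace (G : Submonoid (Op (Fin n)))
    (hone : ∀ i, ∀ U ∈ Matrix.unitaryGroup (Fin 2) ℂ, onQubit i U ∈ G) (i : Fin n) :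
    (fun x => bitSign (x i)) ∈ phaseSpace G := by
  intro t
  rw [← onQubit_diagonal i fun s => Complex.exp (((t * bitSign s : ℝ) : ℂ) * Complex.I)]
  apply hone
  exact diagonal_mem_unitary fun s => Complex.norm_exp_ofReal_mul_I _

/-- Conjugating by the controlled-not from `i` to `j` replaces the bit at `j` by its sum with the
bit at `i`, so a parity containing `j` acquires the factor for `i`. The empty parity is a global
phase. -/
theorem prod_bitSign_mem_phaseSpace (G : Submonoid (Op (Fin n)))
    (hone : ∀ i, ∀ U ∈ Matrix.unitaryGroup (Fin 2) ℂ, onQubit i U ∈ G)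
    (hcnot : ∀ (i j : Fin n) (hij : i ≠ j), cnotOp hij ∈ G)
    (hphase : ∀ c : ℂ, ‖c‖ = 1 → c • (1 : Op (Fin n)) ∈ G) (S : Finset (Fin n)) :
    (fun x => ∏ i ∈ S, bitSign (x i)) ∈ phaseSpace G := by
  rcases S.eq_empty_or_nonempty with rfl | hS
  · intro t
    have := hphase (Complex.exp ((t : ℂ) * Complex.I)) (Complex.norm_exp_ofReal_mul_I t)
    rw [← Matrix.diagonal_one, ← Matrix.diagonal_smul] at this
    convert this using 3 with x
    simp
  induction hS using Finset.Nonempty.cons_induction with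
  | singleton i => simpa using bitSign_mem_phaseSpace G hone i
  | cons i S hi hS ih =>
    obtain ⟨j, hj⟩ := hS
    have hij : i ≠ j := fun h => hi (h ▸ hj)
    intro t
    have := mul_mem (mul_mem (hcnot i j hij) (ih t)) (hcnot i j hij)
    rw [cnotOp_mul_diagonal_mul] at this
    convert this using 7 with x
    beta_reduce
    rw [Finset.prod_cons, ← Finset.mul_prod_erase _ _ hj, ← Finset.mul_prod_erase _ _ hj,
      Function.update_self, bitSign_add, mul_assoc]
    congr 2
    refine Finset.prod_congr rfl fun k hk => ?_
    rw [Function.update_of_ne (Finset.ne_of_mem_erase hk)]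

/-- The indicator of `y` is the product over qubits of `(1 + bitSign (y i) * bitSign (x i)) / 2`;
expanded, it is a real combination of parities. Indicators span all functions. -/
theorem phaseSpace_eq_top (G : Submonoid (Op (Fin n)))
    (hone : ∀ i, ∀ U ∈ Matrix.unitaryGroup (Fin 2) ℂ, onQubit i U ∈ G)
    (hcnot : ∀ (i j : Fin n) (hij : i ≠ j), cnotOp hij ∈ G)
    (hphase : ∀ c : ℂ, ‖c‖ = 1 → c • (1 : Op (Fin n)) ∈ G) : phaseSpace G = ⊤ := by
  have hind : ∀ (y : Fin n → Fin 2) (A S : Finset (Fin n)),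
      (fun x => (∏ i ∈ A, (1 + bitSign (y i) * bitSign (x i)) / 2) * ∏ i ∈ S, bitSign (x i)) ∈
        phaseSpace G := by
    intro y A
    induction A using Finset.induction_on with
    | empty =>
      intro S
      simpa using prod_bitSign_mem_phaseSpace G hone hcnot hphase S
    | insert j A hj ih =>
      intro S
      have h1 := (phaseSpace G).smul_mem (2⁻¹ : ℝ) (ih S)
      -- Signs square to 1, so multiplying the parity of `S` by the sign at `j` gives the parity of
      -- the symmetric difference of `S` and `{j}`. This is why the induction keeps `S` arbitrary.
      have h2 := (phaseSpace G).smul_mem (2⁻¹ * bitSign (y j) : ℝ)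
        (ih (if j ∈ S then S.erase j else insert j S))
      convert (phaseSpace G).add_mem h1 h2 using 1
      funext x
      simp only [Pi.add_apply, Pi.smul_apply, smul_eq_mul]
      have hS : ∏ i ∈ (if j ∈ S then S.erase j else insert j S), bitSign (x i) =
          bitSign (x j) * ∏ i ∈ S, bitSign (x i) := by
        split_ifs with h
        · rw [← Finset.mul_prod_erase S _ h, ← mul_assoc, bitSign_mul_self, one_mul]
        · rw [Finset.prod_insert h]
      rw [hS, Finset.prod_insert hj]
      ring
  rw [eq_top_iff]
  rintro f -
  have hsum : f = ∑ y, f y • fun x : Fin n → Fin 2 =>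
      (∏ i ∈ Finset.univ, (1 + bitSign (y i) * bitSign (x i)) / 2) *
        ∏ i ∈ (∅ : Finset (Fin n)), bitSign (x i) := by
    funext x
    rw [Finset.sum_apply, Finset.sum_eq_single x]
    · have : (1 + 1 : ℝ) / 2 = 1 := by norm_num
      simp only [Pi.smul_apply, bitSign_mul_self, this]
      simp
    · intro y _ hyx
      obtain ⟨i, hi⟩ := Function.ne_iff.1 hyx
      have : (1 + bitSign (y i) * bitSign (x i)) / 2 = 0 := by
        have : ∀ s t : Fin 2, s ≠ t → (1 + bitSign s * bitSign t) / 2 = 0 := by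
          intro s t
          fin_cases s <;> fin_cases t <;> simp [bitSign]
        exact this _ _ hi
      simp only [Pi.smul_apply]
      rw [Finset.prod_eq_zero (Finset.mem_univ i) this, zero_mul, smul_zero]
    · simp
  rw [hsum]
  exact Submodule.sum_mem _ fun y _ => Submodule.smul_mem _ _ (hind y _ _)

theorem diagonal_mem_of_gates (G : Submonoid (Op (Fin n)))
    (hone : ∀ i, ∀ U ∈ Matrix.unitaryGroup (Fin 2) ℂ, onQubit i U ∈ G)
    (hcnot : ∀ (i j : Fin n) (hij : i ≠ j), cnotOp hij ∈ G)
    (hphase : ∀ c : ℂ, ‖c‖ = 1 → c • (1 : Op (Fin n)) ∈ G)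
    (d : (Fin n → Fin 2) → ℂ) (hd : ∀ x, ‖d x‖ = 1) : Matrix.diagonal d ∈ G := by
  have h : (fun x => Complex.arg (d x)) ∈ phaseSpace G := by
    rw [phaseSpace_eq_top G hone hcnot hphase]; trivial
  convert h 1 using 2
  funext x
  have := Complex.norm_mul_exp_arg_mul_I (d x)
  rw [hd, Complex.ofReal_one, one_mul] at this
  simpa using this.symm

end Diagonal

/-! ### Generation of the unitary group by gates -/

section Gates

variable {n : ℕ}

theorem diagonal_mem_unitaryPart {ι : Type} [Fintype ι] [DecidableEq ι]
    (G : Submonoid (Matrix ι ι ℂ))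
    (hdiag : ∀ d : ι → ℂ, (∀ k, ‖d k‖ = 1) → Matrix.diagonal d ∈ G) {d : ι → ℂ}
    (hd : ∀ x, ‖d x‖ = 1) : Matrix.diagonal d ∈ unitaryPart G := by
  refine ⟨hdiag d hd, ?_, diagonal_mem_unitary hd⟩
  rw [Matrix.diagonal_conjTranspose]
  exact hdiag _ fun k => by simp [hd]

/-- The matrix `S H`, whose columns are the eigenvectors of the real rotations. -/
def gateSH : Mat1 := ((Real.sqrt 2 : ℝ) : ℂ)⁻¹ • !![1, 1; Complex.I, -Complex.I]

theorem gateSH_conjTranspose :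
    gateSHᴴ = ((Real.sqrt 2 : ℝ) : ℂ)⁻¹ • !![1, -Complex.I; 1, Complex.I] := by
  ext i j; fin_cases i <;> fin_cases j <;> simp [gateSH, Complex.conj_ofReal]

theorem gateSH_mem_unitary : gateSH ∈ Matrix.unitaryGroup (Fin 2) ℂ := by
  rw [Matrix.mem_unitaryGroup_iff, Matrix.star_eq_conjTranspose, gateSH_conjTranspose, gateSH]
  have h := invSqrtTwo_mul_self
  have hI := Complex.I_mul_I
  ext i j
  fin_cases i <;> fin_cases j <;> simp [Matrix.mul_apply, Fin.sum_univ_two]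
  · linear_combination 2 * h
  · linear_combination 2 * h - 2 * ((Real.sqrt 2 : ℝ) : ℂ)⁻¹ * ((Real.sqrt 2 : ℝ) : ℂ)⁻¹ * hI

/-- The phase `(a + b i) / √(a² + b²)`. -/
def unitPhase (a b : ℝ) : ℂ :=
  if a = 0 ∧ b = 0 then 1 else (a + b * Complex.I) / Real.sqrt (a ^ 2 + b ^ 2)

theorem norm_unitPhase (a b : ℝ) : ‖unitPhase a b‖ = 1 := by
  rw [unitPhase]
  split_ifs with h
  · simp
  · have hpos : 0 < a ^ 2 + b ^ 2 := by
      rcases not_and_or.1 h with h | h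
      · have := sq_pos_of_ne_zero h; positivity
      · have := sq_pos_of_ne_zero h; positivity
    rw [norm_div, Complex.norm_add_mul_I, Complex.norm_real, Real.norm_of_nonneg (Real.sqrt_nonneg _),
      div_self (Real.sqrt_pos.2 hpos).ne']

theorem unitPhase_mul (a b : ℝ) :
    unitPhase a b * (a - b * Complex.I) = Real.sqrt (a ^ 2 + b ^ 2) := by
  rw [unitPhase]
  split_ifs with h
  · simp [h.1, h.2]
  · have hpos : 0 < a ^ 2 + b ^ 2 := by
      rcases not_and_or.1 h with h | h
      · have := sq_pos_of_ne_zero h; positivity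
      · have := sq_pos_of_ne_zero h; positivity
    have hne : ((Real.sqrt (a ^ 2 + b ^ 2) : ℝ) : ℂ) ≠ 0 :=
      Complex.ofReal_ne_zero.2 (Real.sqrt_pos.2 hpos).ne'
    have hsq : ((Real.sqrt (a ^ 2 + b ^ 2) : ℝ) : ℂ) * (Real.sqrt (a ^ 2 + b ^ 2) : ℝ) =
        (a : ℂ) ^ 2 + (b : ℂ) ^ 2 := by
      rw [← Complex.ofReal_mul, Real.mul_self_sqrt hpos.le]; push_cast; ring
    rw [div_mul_eq_mul_div, div_eq_iff hne, hsq]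
    linear_combination -(b : ℂ) ^ 2 * Complex.I_mul_I

/-- A rotation of the qubit `j`, controlled by all other qubits, that moves the amplitudes to the
states with `x j = 0`. -/
theorem exists_rotation (G : Submonoid (Op (Fin n)))
    (hone : ∀ i, ∀ U ∈ Matrix.unitaryGroup (Fin 2) ℂ, onQubit i U ∈ G)
    (hdiag : ∀ d : (Fin n → Fin 2) → ℂ, (∀ x, ‖d x‖ = 1) → Matrix.diagonal d ∈ G)
    (v : (Fin n → Fin 2) → ℝ) (j : Fin n) :
    ∃ g ∈ unitaryPart G, ∀ x, (g *ᵥ fun y => (v y : ℂ)) x = ((if x j = 0 then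
      Real.sqrt (v (Function.update x j 0) ^ 2 + v (Function.update x j 1) ^ 2) else 0 : ℝ) : ℂ) := by
  have hW : onQubit j gateSH ∈ unitaryPart G := ⟨hone j _ gateSH_mem_unitary, by
    rw [onQubit_conjTranspose]; exact hone j _ (Unitary.star_mem gateSH_mem_unitary),
    onQubit_mem_unitary j gateSH_mem_unitary⟩
  have hW' : onQubit j gateSHᴴ ∈ unitaryPart G := by
    rw [← onQubit_conjTranspose]; exact conjTranspose_mem_unitaryPart hW
  -- In the basis given by `gateSH` a real rotation is diagonal with conjugate entries. Here its
  -- angle depends on the other bits only; the bit at `j` selects between the two conjugate phases.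
  set d : (Fin n → Fin 2) → ℂ := fun x =>
    unitPhase (v (Function.update x j 0)) (bitSign (x j) * v (Function.update x j 1)) with hd
  have hD : Matrix.diagonal d ∈ unitaryPart G :=
    diagonal_mem_unitaryPart G hdiag fun x => norm_unitPhase _ _
  refine ⟨_, mul_mem (mul_mem hW hD) hW', fun x => ?_⟩
  rw [← Matrix.mulVec_mulVec, ← Matrix.mulVec_mulVec, onQubit_mulVec]
  simp only [Fin.sum_univ_two, Matrix.mulVec_diagonal, onQubit_mulVec, hd, Function.update_self,
    Function.update_idem]
  set a := v (Function.update x j 0)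
  set b := v (Function.update x j 1)
  have h0 := unitPhase_mul a b
  have h1 := unitPhase_mul a (-b)
  rw [neg_sq] at h1
  push_cast at h1
  have hc := invSqrtTwo_mul_self
  rw [gateSH_conjTranspose]
  simp only [gateSH, bitSign, if_true, one_ne_zero, if_false, one_mul, neg_one_mul]
  set r := ((Real.sqrt (a ^ 2 + b ^ 2) : ℝ) : ℂ)
  set c := ((Real.sqrt 2 : ℝ) : ℂ)⁻¹
  generalize x j = t
  fin_cases t
  · simp
    linear_combination c * c * h0 + c * c * h1 + 2 * r * hc
  · simp
    linear_combination Complex.I * (c * c * h0 - c * c * h1)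

/-- A diagonal operator makes all amplitudes real, and each rotation then empties the half of the
states where its qubit is 1. Rotations of other qubits keep that half empty, so only the all-zero
state remains. -/
theorem exists_map_to_basis_vector (G : Submonoid (Op (Fin n)))
    (hone : ∀ i, ∀ U ∈ Matrix.unitaryGroup (Fin 2) ℂ, onQubit i U ∈ G)
    (hdiag : ∀ d : (Fin n → Fin 2) → ℂ, (∀ x, ‖d x‖ = 1) → Matrix.diagonal d ∈ G)
    (v : (Fin n → Fin 2) → ℂ) : ∃ g ∈ unitaryPart G, ∃ k c, g *ᵥ v = Pi.single k c := by
  have key : ∀ S : Finset (Fin n), ∃ g ∈ unitaryPart G, ∃ w : (Fin n → Fin 2) → ℝ,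
      (g *ᵥ v = fun x => (w x : ℂ)) ∧ ∀ x, ∀ i ∈ S, x i ≠ 0 → w x = 0 := by
    intro S
    induction S using Finset.induction_on with
    | empty =>
      refine ⟨Matrix.diagonal fun x => unitPhase (v x).re (-(v x).im),
        diagonal_mem_unitaryPart G hdiag fun x => norm_unitPhase _ _,
        fun x => Real.sqrt ((v x).re ^ 2 + (-(v x).im) ^ 2), ?_, by simp⟩
      funext x
      rw [Matrix.mulVec_diagonal, ← unitPhase_mul]
      congr 1
      push_cast
      rw [neg_mul, sub_neg_eq_add, Complex.re_add_im]
    | insert j S hj ih =>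
      obtain ⟨g, hg, w, hw, hS⟩ := ih
      obtain ⟨g', hg', hw'⟩ := exists_rotation G hone hdiag w j
      refine ⟨g' * g, mul_mem hg' hg, fun x => if x j = 0 then Real.sqrt
        (w (Function.update x j 0) ^ 2 + w (Function.update x j 1) ^ 2) else 0, ?_, ?_⟩
      · rw [← Matrix.mulVec_mulVec, hw]
        funext x
        exact hw' x
      · intro x i hi hxi
        beta_reduce
        split_ifs with h0
        · have hij : i ≠ j := fun h => hxi (h ▸ h0)
          have hiS : i ∈ S := (Finset.mem_insert.1 hi).resolve_left hij
          rw [hS _ i hiS (by rwa [Function.update_of_ne hij]),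
            hS _ i hiS (by rwa [Function.update_of_ne hij])]
          simp
        · rfl
  obtain ⟨g, hg, w, hw, hS⟩ := key Finset.univ
  refine ⟨g, hg, 0, (w 0 : ℂ), ?_⟩
  rw [hw]
  funext x
  by_cases hx : x = 0
  · simp [hx]
  · obtain ⟨i, hi⟩ := Function.ne_iff.1 hx
    rw [hS x i (Finset.mem_univ i) hi, Pi.single_eq_of_ne hx, Complex.ofReal_zero]

/-- One-qubit unitary operators, controlled-nots and phases generate all unitary operators. -/
theorem unitary_mem_of_gates (G : Submonoid (Op (Fin n)))
    (hone : ∀ i, ∀ U ∈ Matrix.unitaryGroup (Fin 2) ℂ, onQubit i U ∈ G)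
    (hcnot : ∀ (i j : Fin n) (hij : i ≠ j), cnotOp hij ∈ G)
    (hphase : ∀ c : ℂ, ‖c‖ = 1 → c • (1 : Op (Fin n)) ∈ G)
    (U : Op (Fin n)) (hU : U ∈ Matrix.unitaryGroup (Fin n → Fin 2) ℂ) : U ∈ G := by
  have hdiag := diagonal_mem_of_gates G hone hcnot hphase
  exact unitary_mem_of_transitive G hdiag (exists_map_to_basis_vector G hone hdiag) U hU

/-- The operators programmed with the observables `O`, as a monoid. -/
def programmableMonoid (O : Family) (n : ℕ) : Submonoid (Op (Fin n)) where
  carrier := {U | Programmable O U}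
  one_mem' := Programmable.one O
  mul_mem' := fun ha hb => ha.mul hb

theorem exactlyUniversal_allObs : ExactlyUniversal allObs := fun n U hU =>
  Programmable.simulable <| unitary_mem_of_gates (programmableMonoid allObs n)
    (fun i V hV => programmable_onQubit_allObs i ⟨V, hV⟩)
    (fun _ _ hij => (programmable_cnotOp hij).mono (Set.subset_univ _) (Set.subset_univ _))
    (fun c hc => (Programmable.one allObs).smul (by rintro rfl; simp at hc)) U hU

end Gates

/-! ### Density of the group generated by `H` and `T` -/

theorem norm_zeta8 : ‖zeta8‖ = 1 := by
  have := zeta8_mul_star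
  rw [Complex.star_def, Complex.mul_conj, Complex.normSq_eq_norm_sq] at this
  have h2 : ‖zeta8‖ ^ 2 = 1 := by exact_mod_cast this
  exact (pow_eq_one_iff_of_nonneg (norm_nonneg _) two_ne_zero).1 h2

theorem gateSH_mul_diag_mul (z : ℂ) : gateSH * !![1, 0; 0, z] * gateSHᴴ =
    (2 : ℂ)⁻¹ • !![1 + z, -Complex.I * (1 - z); Complex.I * (1 - z), 1 + z] := by
  have h := invSqrtTwo_mul_self
  have hI := Complex.I_mul_I
  rw [gateSH_conjTranspose, gateSH]
  generalize ((Real.sqrt 2 : ℝ) : ℂ)⁻¹ = c at *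
  ext i j
  fin_cases i <;> fin_cases j <;> simp [Matrix.mul_apply, Fin.sum_univ_two] <;> grind

theorem gateT_conjTranspose : gateTᴴ = !![1, 0; 0, star zeta8] := by
  ext i j; fin_cases i <;> fin_cases j <;> simp [gateT_eq]

theorem gateH_mul_gateT_mul : gateH * gateT * gateH =
    (2 : ℂ)⁻¹ • !![1 + zeta8, 1 - zeta8; 1 - zeta8, 1 + zeta8] := by
  have h := invSqrtTwo_mul_self
  rw [gateH, gateT_eq]
  generalize ((Real.sqrt 2 : ℝ) : ℂ)⁻¹ = c at *
  ext i j
  fin_cases i <;> fin_cases j <;> simp [Matrix.mul_apply, Fin.sum_univ_two] <;> grind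

/-- A product of gates `H` and `T` that is, up to a phase, a rotation about an axis orthogonal to
the `Z` axis. -/
theorem gate_word_eq :
    (gateSH * gateT * gateSHᴴ) * gateT * (gateH * gateT * gateH) * (gateSH * gateTᴴ * gateSHᴴ) =
      zeta8 • !![((2 + Real.sqrt 2 : ℝ) : ℂ) / 4,
          -(((2 - Real.sqrt 2 : ℝ) : ℂ) / 4 + Complex.I / 2);
        ((2 - Real.sqrt 2 : ℝ) : ℂ) / 4 - Complex.I / 2, ((2 + Real.sqrt 2 : ℝ) : ℂ) / 4] := by
  rw [gateH_mul_gateT_mul, gateT_conjTranspose, gateT_eq, gateSH_mul_diag_mul,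
    gateSH_mul_diag_mul, star_zeta8, zeta8_eq]
  have h := invSqrtTwo_mul_self
  have hI := Complex.I_mul_I
  have hs : ((Real.sqrt 2 : ℝ) : ℂ) = 2 * ((Real.sqrt 2 : ℝ) : ℂ)⁻¹ := by
    have : ((Real.sqrt 2 : ℝ) : ℂ) ≠ 0 := by simp
    rw [eq_mul_inv_iff_mul_eq₀ this, ← Complex.ofReal_mul, Real.mul_self_sqrt (by norm_num)]
    norm_num
  push_cast
  generalize ((Real.sqrt 2 : ℝ) : ℂ)⁻¹ = c at *
  rw [hs]
  ext i j
  fin_cases i <;> fin_cases j <;> simp [Matrix.mul_apply, Fin.sum_univ_two] <;> grind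

theorem gateSH_eq : gateSH = gateT ^ 2 * gateH := by
  have h := zeta8_sq
  rw [pow_two] at h ⊢
  rw [gateT_eq, gateSH, gateH]
  ext i j
  fin_cases i <;> fin_cases j <;> simp [Matrix.mul_apply, Fin.sum_univ_two, h, mul_comm]

/-- The real rotations. -/
def rotation (z : ℂ) : Mat1 := !![(z.re : ℂ), -(z.im : ℂ); (z.im : ℂ), (z.re : ℂ)]

theorem rotation_mul (z w : ℂ) : rotation (z * w) = rotation z * rotation w := by
  ext i j
  fin_cases i <;> fin_cases j <;> simp [rotation, Matrix.mul_apply, Fin.sum_univ_two] <;> ring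

theorem rotation_one : rotation 1 = 1 := by
  ext i j
  fin_cases i <;> fin_cases j <;> simp [rotation]

theorem rotation_conjTranspose (z : ℂ) : (rotation z)ᴴ = rotation (star z) := by
  ext i j
  fin_cases i <;> fin_cases j <;> simp [rotation, Complex.conj_ofReal]

theorem continuous_rotation : Continuous rotation := by
  refine continuous_pi fun i => continuous_pi fun j => ?_
  fin_cases i <;> fin_cases j <;> simp [rotation] <;> fun_prop

theorem rotation_mem_unitary {z : ℂ} (hz : ‖z‖ = 1) :
    rotation z ∈ Matrix.unitaryGroup (Fin 2) ℂ := by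
  rw [Matrix.mem_unitaryGroup_iff, Matrix.star_eq_conjTranspose, rotation_conjTranspose,
    ← rotation_mul, Complex.star_def, Complex.mul_conj, Complex.normSq_eq_norm_sq, hz]
  simp [rotation_one]

/-- A complex number with real part `(2 + √2) / 4` is not a root of unity. -/
theorem pow_ne_one_of_re {z : ℂ} (hre : z.re = (2 + Real.sqrt 2) / 4) {k : ℕ}
    (hk : 0 < k) : z ^ k ≠ 1 := by
  intro h
  have hroot : ∀ w : ℂ, w ^ k = 1 → IsIntegral ℤ w := by
    intro w hw
    refine IsIntegral.of_pow hk ?_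
    rw [hw]
    exact isIntegral_one
  -- A root of unity and its conjugate are algebraic integers, so subtracting 1 from their sum would
  -- make `√2/2`, and hence its square `1/2`, an algebraic integer.
  have h1 : IsIntegral ℤ (z + star z) :=
    (hroot z h).add (hroot _ (by rw [← star_pow, h, star_one]))
  have h2 : z + star z = 1 + ((Real.sqrt 2 / 2 : ℝ) : ℂ) := by
    rw [Complex.star_def, Complex.add_conj, hre]
    push_cast
    ring
  have h3 : IsIntegral ℤ (((Real.sqrt 2 / 2 : ℝ) : ℂ) ^ 2) := by
    have := (h1.sub isIntegral_one).pow 2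
    rwa [h2, add_sub_cancel_left] at this
  have h4 : (((Real.sqrt 2 / 2 : ℝ) : ℂ) ^ 2) = algebraMap ℚ ℂ (1 / 2) := by
    rw [← Complex.ofReal_pow, div_pow, Real.sq_sqrt (by norm_num)]
    norm_num
  rw [h4, isIntegral_algebraMap_iff (algebraMap ℚ ℂ).injective] at h3
  obtain ⟨m, hm⟩ := IsIntegrallyClosed.isIntegral_iff.1 h3
  have h5 : (2 * m : ℤ) = 1 := by
    have : (2 : ℚ) * m = 1 := by
      rw [show (m : ℚ) = algebraMap ℤ ℚ m from rfl, hm]; norm_num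
    exact_mod_cast this
  omega

/-- The powers of an element of the circle that is not a root of unity are dense. -/
theorem dense_pow_of_ne_one {z : Circle} (hz : ∀ k : ℕ, 0 < k → z ^ k ≠ 1) :
    DenseRange fun k : ℕ => z ^ k := by
  rw [← denseRange_zpow_iff_pow]
  have : Fact ((0 : ℝ) < 1) := ⟨one_pos⟩
  obtain ⟨a, rfl⟩ := (AddCircle.homeomorphCircle (T := 1) one_ne_zero).surjective z
  rw [AddCircle.homeomorphCircle_apply] at hz ⊢
  have hord : addOrderOf a = 0 := by
    rw [addOrderOf_eq_zero_iff']
    intro k hk h0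
    apply hz k hk
    rw [← AddCircle.toCircle_nsmul, h0, AddCircle.toCircle_zero]
  have hd := AddCircle.denseRange_zsmul_iff.2 hord
  have hd' := (AddCircle.homeomorphCircle (T := 1) one_ne_zero).surjective.denseRange.comp hd
    (AddCircle.homeomorphCircle (T := 1) one_ne_zero).continuous
  convert hd' using 1
  funext k
  simp [AddCircle.homeomorphCircle_apply, AddCircle.toCircle_zsmul]

/-- A closed monoid of matrices that contains the phases, `S` and a rotation of infinite order
contains all unitary matrices. -/
theorem unitary_mem_of_rotation (K : Submonoid Mat1) (hK : IsClosed (K : Set Mat1))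
    (hphase : ∀ c : ℂ, ‖c‖ = 1 → c • (1 : Mat1) ∈ K) (hS : gateT ^ 2 ∈ K) {z₀ : ℂ}
    (hz₀ : ‖z₀‖ = 1) (hre : z₀.re = (2 + Real.sqrt 2) / 4) (hrot : rotation z₀ ∈ K)
    (U : Mat1) (hU : U ∈ Matrix.unitaryGroup (Fin 2) ℂ) : U ∈ K := by
  have hrotK : ∀ z : ℂ, ‖z‖ = 1 → rotation z ∈ K := by
    have hcl : IsClosed {z : Circle | rotation z ∈ K} :=
      hK.preimage (continuous_rotation.comp continuous_subtype_val)
    let z₁ : Circle := ⟨z₀, mem_sphere_zero_iff_norm.2 hz₀⟩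
    have hdense : DenseRange fun k : ℕ => z₁ ^ k := by
      refine dense_pow_of_ne_one fun k hk h => pow_ne_one_of_re hre hk ?_
      have h' := congrArg (fun z : Circle => (z : ℂ)) h
      simp only [Circle.coe_pow, Circle.coe_one] at h'
      exact h'
    have hpow : ∀ k : ℕ, rotation ((z₁ ^ k : Circle) : ℂ) ∈ K := by
      intro k
      induction k with
      | zero => simp [rotation_one]
      | succ k ih =>
        rw [pow_succ, Circle.coe_mul, rotation_mul]
        exact mul_mem ih hrot
    intro z hz
    have hmem : (⟨z, mem_sphere_zero_iff_norm.2 hz⟩ : Circle) ∈ {z : Circle | rotation z ∈ K} :=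
      hcl.closure_subset_iff.2 (Set.range_subset_iff.2 hpow) (hdense _)
    exact hmem
  have hZ : pauliZ ∈ K := by
    have : pauliZ = gateT ^ 2 * gateT ^ 2 := by
      have h : zeta8 * (zeta8 * zeta8 * zeta8) = -1 := by
        have := zeta8_sq
        linear_combination (zeta8 ^ 2 + Complex.I) * this + Complex.I_mul_I
      rw [gateT_eq, pow_two]
      ext i j
      fin_cases i <;> fin_cases j <;> simp [pauliZ, Matrix.mul_apply, Fin.sum_univ_two]
      linear_combination -h
    rw [this]
    exact mul_mem hS hS
  have hH : gateH ∈ K := by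
    -- `H` is a reflection of the real plane: the rotation by `π/4` after `Z`. With `S` and `Z` at
    -- hand, `gateSH` and its adjoint follow.
    have h8 : rotation zeta8 * pauliZ = gateH := by
      have hr : zeta8.re = (Real.sqrt 2)⁻¹ := by
        rw [zeta8_eq, ← Complex.ofReal_inv, Complex.re_ofReal_mul]; simp
      have hi : zeta8.im = (Real.sqrt 2)⁻¹ := by
        rw [zeta8_eq, ← Complex.ofReal_inv, Complex.im_ofReal_mul]; simp
      ext i j
      fin_cases i <;> fin_cases j <;>
        simp [rotation, hr, hi, pauliZ, gateH, Matrix.mul_apply, Fin.sum_univ_two]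
    rw [← h8]
    refine mul_mem (hrotK _ ?_) hZ
    exact norm_zeta8
  have hE : gateSH ∈ K := by
    rw [gateSH_eq]; exact mul_mem hS hH
  have hE' : gateSHᴴ ∈ K := by
    have : gateSHᴴ = gateH * (gateT ^ 2 * pauliZ) := by
      rw [gateSH_conjTranspose, pow_two, gateT_eq, gateH]
      have h := zeta8_sq
      rw [pow_two] at h
      ext i j
      fin_cases i <;> fin_cases j <;>
        simp [pauliZ, Matrix.mul_apply, Fin.sum_univ_two, h]
    rw [this]
    exact mul_mem hH (mul_mem hS hZ)
  have hdiag : ∀ d : Fin 2 → ℂ, (∀ k, ‖d k‖ = 1) → Matrix.diagonal d ∈ K := by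
    have hspecial : ∀ z : ℂ, ‖z‖ = 1 → Matrix.diagonal ![z, star z] ∈ K := by
      intro z hz
      have : Matrix.diagonal ![z, star z] = gateSHᴴ * rotation (star z) * gateSH := by
        have h := invSqrtTwo_mul_self
        have hI := Complex.I_mul_I
        have hz := Complex.re_add_im z
        have hz' : (starRingEnd ℂ) z = z.re - z.im * Complex.I := by
          apply Complex.ext <;> simp
        rw [gateSH_conjTranspose, gateSH]
        generalize ((Real.sqrt 2 : ℝ) : ℂ)⁻¹ = c at *
        ext i j
        fin_cases i <;> fin_cases j <;>
          simp [rotation, Matrix.mul_apply, Fin.sum_univ_two] <;> grind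
      rw [this]
      exact mul_mem (mul_mem hE' (hrotK _ (by simpa using hz))) hE
    intro d hd
    -- The half-sum of the arguments is a global phase; the half-difference gives a diagonal matrix
    -- of determinant 1, which is a real rotation conjugated by `gateSH`.
    set α := (Complex.arg (d 0) + Complex.arg (d 1)) / 2 with hα
    set β := (Complex.arg (d 0) - Complex.arg (d 1)) / 2 with hβ
    have hm := mul_mem (hphase _ (Complex.norm_exp_ofReal_mul_I α))
      (hspecial _ (Complex.norm_exp_ofReal_mul_I β))
    convert hm using 1
    rw [smul_mul_assoc, one_mul, ← Matrix.diagonal_smul]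
    congr 1
    have harg : ∀ k, d k = Complex.exp (Complex.arg (d k) * Complex.I) := by
      intro k
      have := Complex.norm_mul_exp_arg_mul_I (d k)
      rw [hd, Complex.ofReal_one, one_mul] at this
      exact this.symm
    funext k
    fin_cases k
    · simp only [Fin.zero_eta, Pi.smul_apply, Matrix.cons_val_zero, smul_eq_mul]
      refine (harg 0).trans ?_
      rw [← Complex.exp_add]
      congr 1
      rw [hα, hβ]
      push_cast
      ring
    · change d 1 = Complex.exp (α * Complex.I) * star (Complex.exp (β * Complex.I))
      refine (harg 1).trans ?_
      rw [Complex.star_def, ← Complex.exp_conj, ← Complex.exp_add]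
      congr 1
      rw [hα, hβ, map_mul, Complex.conj_ofReal, Complex.conj_I]
      push_cast
      ring
  -- Transitivity on vectors: diagonal phases make both entries nonnegative reals, and a real
  -- rotation then annihilates the second one.
  refine unitary_mem_of_transitive K hdiag (fun v => ?_) U hU
  have hrotK' : ∀ z : ℂ, ‖z‖ = 1 → rotation z ∈ unitaryPart K := fun z hz =>
    ⟨hrotK z hz, by rw [rotation_conjTranspose]; exact hrotK _ (by simpa using hz),
      rotation_mem_unitary hz⟩
  set a := Real.sqrt ((v 0).re ^ 2 + (-(v 0).im) ^ 2) with ha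
  set b := Real.sqrt ((v 1).re ^ 2 + (-(v 1).im) ^ 2) with hb
  have hD := diagonal_mem_unitaryPart K hdiag (d := fun k => unitPhase (v k).re (-(v k).im))
    fun k => norm_unitPhase _ _
  refine ⟨_, mul_mem (hrotK' (unitPhase a (-b)) (norm_unitPhase _ _)) hD, 0,
    (Real.sqrt (a ^ 2 + (-b) ^ 2) : ℂ), ?_⟩
  have hDv : (Matrix.diagonal fun k => unitPhase (v k).re (-(v k).im)) *ᵥ v =
      ![(a : ℂ), (b : ℂ)] := by
    have hk : ∀ k, unitPhase (v k).re (-(v k).im) * v k =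
        Real.sqrt ((v k).re ^ 2 + (-(v k).im) ^ 2) := by
      intro k
      rw [← unitPhase_mul]
      congr 1
      push_cast
      rw [neg_mul, sub_neg_eq_add, Complex.re_add_im]
    funext k
    rw [Matrix.mulVec_diagonal, hk]
    fin_cases k <;> rfl
  rw [← Matrix.mulVec_mulVec, hDv]
  have hmul := unitPhase_mul a (-b)
  have hre' := congrArg Complex.re hmul
  have him' := congrArg Complex.im hmul
  simp at hre' him'
  have hre'' := congrArg (fun r : ℝ => (r : ℂ)) hre'
  have him'' := congrArg (fun r : ℝ => (r : ℂ)) him'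
  push_cast at hre'' him''
  funext k
  fin_cases k
  · simp [rotation, Matrix.mulVec, dotProduct, Fin.sum_univ_two]
    linear_combination hre''
  · simp [rotation, Matrix.mulVec, dotProduct, Fin.sum_univ_two]
    linear_combination him''

/-- A closed monoid of matrices that contains the phases, `H` and `T` contains all unitary
matrices. -/
theorem unitary_mem_of_gateH_gateT (K : Submonoid Mat1) (hK : IsClosed (K : Set Mat1))
    (hphase : ∀ c : ℂ, ‖c‖ = 1 → c • (1 : Mat1) ∈ K) (hH : gateH ∈ K) (hT : gateT ∈ K)
    (U : Mat1) (hU : U ∈ Matrix.unitaryGroup (Fin 2) ℂ) : U ∈ K := by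
  have hT' : gateTᴴ ∈ K := by
    have h := congrArg Matrix.conjTranspose gateT_eq_conjTranspose_pow
    rw [Matrix.conjTranspose_pow, Matrix.conjTranspose_conjTranspose] at h
    rw [h]
    exact pow_mem hT 7
  have hE : gateSH ∈ K := by rw [gateSH_eq]; exact mul_mem (pow_mem hT 2) hH
  have hE' : gateSHᴴ ∈ K := by
    rw [gateSH_eq, Matrix.conjTranspose_mul, gateH_conjTranspose, Matrix.conjTranspose_pow]
    exact mul_mem hH (pow_mem hT' 2)
  have hζ : zeta8 ≠ 0 := fun h => by simpa [h] using zeta8_mul_star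
  have hζn : ‖zeta8⁻¹‖ = 1 := by
    rw [norm_inv, norm_zeta8, inv_one]
  set a : ℝ := (2 + Real.sqrt 2) / 4 with ha
  set q : ℝ := (2 - Real.sqrt 2) / 4 with hq
  set b : ℂ := q - Complex.I / 2 with hb
  have hword : !![(a : ℂ), -star b; b, (a : ℂ)] ∈ K := by
    have hw := mul_mem (mul_mem (mul_mem (mul_mem (mul_mem hE hT) hE') hT)
      (mul_mem (mul_mem hH hT) hH)) (mul_mem (mul_mem hE hT') hE')
    rw [gate_word_eq] at hw
    have := mul_mem (hphase _ hζn) hw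
    rw [smul_mul_smul_comm, inv_mul_cancel₀ hζ, one_smul, one_mul] at this
    convert this using 1
    ext i j
    fin_cases i <;> fin_cases j <;> simp [a, b, q, Complex.conj_ofReal]
    ring
  have hnorm : a ^ 2 + ‖b‖ ^ 2 = 1 := by
    have h2 : Real.sqrt 2 ^ 2 = 2 := Real.sq_sqrt (by norm_num)
    rw [← Complex.normSq_eq_norm_sq, Complex.normSq_apply]
    simp only [b, Complex.sub_re, Complex.sub_im, Complex.ofReal_re, Complex.ofReal_im]
    simp
    rw [ha, hq]
    linear_combination h2 / 8
  have hb0 : b ≠ 0 := by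
    intro h
    have := congrArg Complex.im h
    simp [b] at this
  have hbn : ((‖b‖ : ℝ) : ℂ) ≠ 0 := Complex.ofReal_ne_zero.2 (norm_ne_zero_iff.2 hb0)
  set u : ℂ := b / ‖b‖ with hu
  have hun : ‖u‖ = 1 := by
    rw [hu, norm_div, Complex.norm_real, norm_norm, div_self (norm_ne_zero_iff.2 hb0)]
  have huu : u * star u = 1 := by
    rw [Complex.star_def, Complex.mul_conj, Complex.normSq_eq_norm_sq, hun]; simp
  have hub : u * ‖b‖ = b := div_mul_cancel₀ b hbn
  -- Conjugation by `D` carries the real rotation `z₀ = a + i‖b‖` to the word found above, so `z₀`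
  -- has its real part `(2 + √2)/4`. As `D` is not known to be in `K`, the argument is run in the
  -- conjugate monoid, which still contains `S` because diagonal matrices commute.
  set D : Mat1 := Matrix.diagonal ![1, u] with hD
  have hDn : ∀ k, ‖(![1, u] : Fin 2 → ℂ) k‖ = 1 := by
    intro k; fin_cases k <;> simp [hun]
  have hDU := diagonal_mem_unitary hDn
  have hDD : D * Dᴴ = 1 := Matrix.mem_unitaryGroup_iff.1 hDU
  have hDD' : Dᴴ * D = 1 := Matrix.mem_unitaryGroup_iff'.1 hDU
  let K' : Submonoid Mat1 :=
    { carrier := {M | D * M * Dᴴ ∈ K}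
      one_mem' := by simp [hDD]
      mul_mem' := fun {M N} hM hN => by
        have := mul_mem (show D * M * Dᴴ ∈ K from hM) (show D * N * Dᴴ ∈ K from hN)
        have h : D * (M * N) * Dᴴ = (D * M * Dᴴ) * (D * N * Dᴴ) := by
          calc D * (M * N) * Dᴴ = D * M * 1 * N * Dᴴ := by simp only [mul_assoc, one_mul]
            _ = _ := by rw [← hDD']; simp only [mul_assoc]
        change D * (M * N) * Dᴴ ∈ K
        rwa [h] }
  have hK' : IsClosed (K' : Set Mat1) :=
    hK.preimage (f := fun M : Mat1 => D * M * Dᴴ) (by fun_prop)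
  have hphase' : ∀ c : ℂ, ‖c‖ = 1 → c • (1 : Mat1) ∈ K' := by
    intro c hc
    change D * (c • (1 : Mat1)) * Dᴴ ∈ K
    rw [mul_smul_comm, smul_mul_assoc, mul_one, hDD]
    exact hphase c hc
  have hS' : gateT ^ 2 ∈ K' := by
    change D * gateT ^ 2 * Dᴴ ∈ K
    have hTd : gateT = Matrix.diagonal ![1, zeta8] := by
      ext i j; fin_cases i <;> fin_cases j <;> simp [gateT_eq]
    have hcomm : D * gateT ^ 2 = gateT ^ 2 * D := by
      rw [hTd, hD, Matrix.diagonal_pow, Matrix.diagonal_mul_diagonal,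
        Matrix.diagonal_mul_diagonal]
      congr 1
      funext k
      exact mul_comm _ _
    rw [hcomm, mul_assoc, hDD, mul_one]
    exact pow_mem hT 2
  set z₀ : ℂ := ⟨a, ‖b‖⟩ with hz₀
  have hz₀n : ‖z₀‖ = 1 := by
    have : ‖z₀‖ ^ 2 = 1 := by
      rw [← Complex.normSq_eq_norm_sq, Complex.normSq_apply, ← hnorm]
      simp [z₀]
      ring
    exact (pow_eq_one_iff_of_nonneg (norm_nonneg _) two_ne_zero).1 this
  have hrot : rotation z₀ ∈ K' := by
    change D * rotation z₀ * Dᴴ ∈ K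
    convert hword using 1
    have hub' : (‖b‖ : ℂ) * star u = star b := by
      rw [← hub, star_mul', Complex.star_def, Complex.conj_ofReal, hub]
      exact mul_comm _ _
    rw [hD, Matrix.diagonal_conjTranspose]
    ext i j
    fin_cases i <;> fin_cases j <;> simp [rotation, z₀, Matrix.mul_apply, Matrix.diagonal_apply]
    · exact hub'
    · exact hub
    · rw [Complex.star_def] at huu
      linear_combination (a : ℂ) * huu
  have hmem := unitary_mem_of_rotation K' hK' hphase' hS' hz₀n rfl hrot (Dᴴ * U * D)
    (mul_mem (mul_mem (Unitary.star_mem hDU) hU) hDU)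
  have : D * (Dᴴ * U * D) * Dᴴ = U := by
    calc D * (Dᴴ * U * D) * Dᴴ = (D * Dᴴ) * U * (D * Dᴴ) := by simp only [mul_assoc]
      _ = U := by rw [hDD, one_mul, mul_one]
  rw [← this]
  exact hmem

/-! ### Universality -/

theorem continuous_onQubit {W : Type} [Fintype W] [DecidableEq W] (a : W) :
    Continuous (onQubit a) := by
  refine continuous_pi fun x => continuous_pi fun y => ?_
  simp only [← toOp_one, LocalOp.toOp, Matrix.of_apply]
  split_ifs
  · fun_prop
  · exact continuous_const

/-- The operators approximated by unitary operators programmed with the observables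
`Z, X, (X+Y)/√2, Z ⊗ X`, as a monoid. -/
def approximableMonoid (n : ℕ) : Submonoid (Op (Fin n)) :=
  (programmableMonoid obsFamily₂ n ⊓
    (Matrix.unitaryGroup (Fin n → Fin 2) ℂ)).topologicalClosure

/-- The closure is itself a monoid with controlled-nots and phases. Its preimage under `onQubit i`
is closed and contains `H`, `T` and the phases, so the density of these one-qubit gates supplies
every one-qubit unitary and exact generation applies to the closure. -/
theorem unitary_mem_approximableMonoid (n : ℕ) (U : Op (Fin n))
    (hU : U ∈ Matrix.unitaryGroup (Fin n → Fin 2) ℂ) : U ∈ approximableMonoid n := by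
  have hsub : ∀ V : Op (Fin n), Programmable obsFamily₂ V →
      V ∈ Matrix.unitaryGroup (Fin n → Fin 2) ℂ → V ∈ approximableMonoid n := fun V h h' =>
    Submonoid.le_topologicalClosure _ ⟨h, h'⟩
  have hphase : ∀ c : ℂ, ‖c‖ = 1 → c • (1 : Op (Fin n)) ∈ approximableMonoid n := by
    intro c hc
    refine hsub _ ((Programmable.one _).smul (by rintro rfl; simp at hc)) ?_
    rw [← Matrix.diagonal_one, ← Matrix.diagonal_smul]
    exact diagonal_mem_unitary fun x => by simp [hc]
  refine unitary_mem_of_gates _ (fun i V hV => ?_)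
    (fun i j hij => hsub _ (programmable_cnotOp hij) (cnotOp_mem_unitary hij)) hphase U hU
  refine unitary_mem_of_gateH_gateT
    ((approximableMonoid n).comap (onQubit i : Mat1 →ₐ[ℂ] Op (Fin n))) ?_ ?_ ?_ ?_ V hV
  · exact (Submonoid.isClosed_topologicalClosure _).preimage (continuous_onQubit i)
  · intro c hc
    rw [Submonoid.mem_comap, map_smul, map_one]
    exact hphase c hc
  · exact hsub _ (programmable_gateH i) (onQubit_mem_unitary i gateH_mem_unitary)
  · exact hsub _ (programmable_gateT i) (onQubit_mem_unitary i gateT_mem_unitary)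

open scoped Matrix.Norms.L2Operator in
theorem universal_of_obsFamily₂_subset {O : Family} (h1 : obsFamily₂.one ⊆ O.one)
    (h2 : obsFamily₂.two ⊆ O.two) : Universal O := by
  intro n U hU ε hε
  have hmem : U ∈ closure ((programmableMonoid obsFamily₂ n ⊓
    (Matrix.unitaryGroup (Fin n → Fin 2) ℂ) : Submonoid (Op (Fin n))) : Set (Op (Fin n))) :=
    unitary_mem_approximableMonoid n U hU
  obtain ⟨V, hV, hd⟩ := Metric.mem_closure_iff.1 hmem ε hε
  refine ⟨V, hV.2, ?_, (Programmable.mono h1 h2 hV.1).simulable⟩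
  rwa [dist_comm, dist_eq_norm] at hd

theorem simulatesCircuits_of_obsFamily₂_subset {O : Family} (h1 : obsFamily₂.one ⊆ O.one)
    (h2 : obsFamily₂.two ⊆ O.two) :
    SimulatesCircuits O gatesHT ∧ SimulatesCircuits O gatesHHT :=
  ⟨fun _ c hc => ((programmable_gatesHT c hc).mono h1 h2).simulable,
    fun _ c hc => ((programmable_gatesHHT c hc).mono h1 h2).simulable⟩

end

end StateTransfer

theorem mainTheorem3 :
    StateTransfer.ExactlyUniversal StateTransfer.allObs ∧
    (StateTransfer.SimulatesCircuits StateTransfer.obsFamily₁ StateTransfer.gatesHT ∧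
      StateTransfer.SimulatesCircuits StateTransfer.obsFamily₁ StateTransfer.gatesHHT ∧
      StateTransfer.Universal StateTransfer.obsFamily₁) ∧
    (StateTransfer.SimulatesCircuits StateTransfer.obsFamily₂ StateTransfer.gatesHT ∧
      StateTransfer.SimulatesCircuits StateTransfer.obsFamily₂ StateTransfer.gatesHHT ∧
      StateTransfer.Universal StateTransfer.obsFamily₂) := by
  have h₁ := StateTransfer.simulatesCircuits_of_obsFamily₂_subset
    StateTransfer.obsFamily₂_one_subset StateTransfer.obsFamily₂_two_subset
  have h₂ := StateTransfer.simulatesCircuits_of_obsFamily₂_subset (O := StateTransfer.obsFamily₂)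
    subset_rfl subset_rfl
  exact ⟨StateTransfer.exactlyUniversal_allObs,
    ⟨h₁.1, h₁.2, StateTransfer.universal_of_obsFamily₂_subset
      StateTransfer.obsFamily₂_one_subset StateTransfer.obsFamily₂_two_subset⟩,
    ⟨h₂.1, h₂.2, StateTransfer.universal_of_obsFamily₂_subset subset_rfl subset_rfl⟩⟩
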